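/- Let $1\le r\le d-1$ be integers, let $\mu$ be the normalized Haar (unitarily invariant) measure on the unit vectors $\psi\in\mathbb{C}^d$, put $\Pi_\psi=|\psi\rangle\langle\psi|$, and let the space of $d\times d$ matrices carry the Hilbert–Schmidt inner product, with $|A\rangle\!\rangle\langle\!\langle B|$ denoting the superoperator $X\mapsto \operatorname{tr}(B^\dagger X)A$. For a full-rank state $\rho$ write $p_\psi=\langle\psi|\rho|\psi\rangle$ and define, for the covariant measurement $\{d\,\Pi_\psi\,\mathrm{d}\mu(\psi)\}$: the frame superoperator $\mathcal{F}(\rho)=d\int \mathrm{d}\mu(\psi)\,p_\psi^{-1}|\Pi_\psi\rangle\!\rangle\langle\!\langle\Pi_\psi|$; the Fisher superoperator $\bar{\mathcal{F}}(\rho)=\bar{\mathbf I}\mathcal{F}(\rho)\bar{\mathbf I}$, where $\bar{\mathbf I}$ is the orthogonal projector onto traceless operators; the optimal reconstruction operators $\Theta_\psi=p_\psi^{-1}\mathcal{F}(\rho)^{-1}\Pi_\psi$; the scaled mean-square-error matrix $\mathcal{C}(\rho)=d\int \mathrm{d}\mu(\psi)\,p_\psi|\Theta_\psi\rangle\!\rangle\langle\!\langle\Theta_\psi|-|\rho\rangle\!\rangle\langle\!\langle\rho|$;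 the scaled mean-square error (MSE) $\mathcal{E}(\rho)=\operatorname{Tr}\mathcal{C}(\rho)$; the scaled mean-square Bures distance (MSB) $\mathcal{E}_{\mathrm{SB}}(\rho)=\operatorname{Tr}\{\mathcal{W}_\rho\,\mathcal{C}(\rho)\}$, where $\mathcal{W}_\rho(X)=\tfrac12 G$ with $\rho G+G\rho=X$ is the weighting matrix of the Bures metric; and the volume of the scaled uncertainty ellipsoid $\mathcal{V}(\rho)=V_{d^2-1}\sqrt{\bar{\operatorname{Det}}\,\mathcal{C}(\rho)}$, where $V_{d^2-1}=\pi^{(d^2-1)/2}/\Gamma(\tfrac{d^2+1}{2})$ and $\bar{\operatorname{Det}}$ is the determinant on the real space of traceless Hermitian operators. Let $\rho_r(s)=\frac{s}{r}\sum_{j=1}^r|j\rangle\langle j|+(1-s)\frac{1}{d}$ with $0\le s<1$, $\lambda_1=\frac{s}{r}+\frac{1-s}{d}$, $\lambda_2=\frac{1-s}{d}$, $E_{jk}=|j\rangle\langle k|$, and $a=g_{20}$, $b=g_{11}$, $c=g_{02}$, where $$g_{jk}=\frac{2dr\,\Gamma(d+1)}{\Gamma(r+j)\Gamma(d-r+k)}\int_0^{\pi/2}\mathrm{d}\alpha\,\frac{(\cos\alpha)^{2r-1+2j}(\sin\alpha)^{2d-2r-1+2k}}{ds(\cos\alpha)^2+r(1-s)},$$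 $$\beta=\frac{(r+1)(d-r)a+r(d-r+1)c-2r(d-r)b}{d}.$$ Then the following hold. (1) $a,b,c,\beta>0$, $\mathcal{F}(\rho_r(s))$ is invertible, and $$\mathcal{F}(\rho_r(s))=a\mathcal{P}_1+b\mathcal{P}_2+c\mathcal{P}_3+\sum_{j,k}\mathcal{M}_{jk}|E_{jj}\rangle\!\rangle\langle\!\langle E_{kk}|,$$ where $\mathcal{P}_1$, $\mathcal{P}_3$, $\mathcal{P}_2$ are the orthogonal projectors onto the spans of the $E_{jk}$ with, respectively, $j\neq k\le r$; $j\ne k$ both $>r$; and exactly one of $j,k$ at most $r$; and $\mathcal{M}_{jk}$ is $(1+\delta_{jk})a$ if $j,k\le r$, $(1+\delta_{jk})c$ if $j,k>r$, and $b$ otherwise. $\bar{\mathcal F}(\rho_r(s))$ has the same form with $\mathcal{M}$ replaced by $\bar{\mathcal M}=\bar I\mathcal{M}\bar I$, where $\bar I$ is the $d\times d$ matrix with entries $\delta_{jk}-1/d$. (2) $\bar{\mathcal M}$ is symmetric; apart from the eigenvalue $0$ of the all-ones vector, it has the eigenvalues $a$, $c$, $\beta$ with multiplicities $r-1$, $d-r-1$,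 $1$. For $j\ne k$ the operators $E_{jk}^{+}=\frac{1}{\sqrt2}(E_{jk}+E_{kj})$ and $E_{jk}^{-}=-\frac{\mathrm i}{\sqrt2}(E_{jk}-E_{kj})$ are eigenvectors of $\mathcal F(\rho_r(s))$ and $\bar{\mathcal F}(\rho_r(s))$, with eigenvalue $a$ if $j,k\le r$, $c$ if $j,k>r$, and $b$ otherwise. $\bar{\mathcal F}(\rho_r(s))$ is Hermitian, annihilates the identity, maps traceless Hermitian operators to traceless Hermitian operators, and on this space has the eigenvalues $a,b,c,\beta$ with multiplicities $r^2-1$, $2r(d-r)$, $(d-r)^2-1$ and $1$ (multiplicities add up if some of the four values coincide). (3) $$\mathcal{E}(\rho_r(s))=\frac{r^2-1}{a}+\frac{2r(d-r)}{b}+\frac{(d-r)^2-1}{c}+\frac1\beta,$$ $$\mathcal{E}_{\mathrm{SB}}(\rho_r(s))=\frac14\Bigl(\frac{r^2-1}{a\lambda_1}+\frac{4r(d-r)}{b(\lambda_1+\lambda_2)}+\frac{(d-r)^2-1}{c\lambda_2}+\frac{d-r}{d\beta\lambda_1}+\frac{r}{d\beta\lambda_2}\Bigr),$$ $$\mathcal{V}(\rho_r(s))=V_{d^2-1}\bigl(a^{r^2-1}b^{2r(d-r)}c^{(d-r)^2-1}\beta\bigr)^{-1/2},$$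 $$\ln\mathcal{V}(\rho_r(s))=\ln V_{d^2-1}-\tfrac12\bigl\{(r^2-1)\ln a+2r(d-r)\ln b+[(d-r)^2-1]\ln c+\ln\beta\bigr\}.$$ (4) For every integer $m\ge0$ and every $u>0$, $$\int_0^{\pi/2}\mathrm{d}\alpha\,\frac{\cos\alpha(\sin\alpha)^{2m+1}}{(\cos\alpha)^2+u}=\frac12(1+u)^m\ln\frac{1+u}{u}-\frac12\sum_{n=0}^{m-1}\frac{(1+u)^n}{m-n}.$$ (5) If $r\ge2$, then as $s\to1^-$ one has $a\to\frac{r}{r+1}$, $b\to1$, $c\to\frac{r}{r-1}$, and $$\mathcal{E}(\rho_r(s))\to d^2+2d-1-\frac{d^2}{r}-\frac1r .$$ -/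

import Mathlib

open Matrix MeasureTheory Filter Topology

noncomputable section

namespace CovTomo

/-- Operators on the `d`-dimensional Hilbert space `ℂ^d`. -/
abbrev Op (d : ℕ) : Type := Matrix (Fin d) (Fin d) ℂ

/-- Superoperators: linear maps on operators. -/
abbrev SuperOp (d : ℕ) : Type := Module.End ℂ (Op d)

/-- The operator `E_{jk} = |j⟩⟨k|` of the standard basis. -/
def E {d : ℕ} (j k : Fin d) : Op d := Matrix.single j k 1

/-- `E_{jk}^+ = (|j⟩⟨k| + |k⟩⟨j|) / √2`. -/
def Eplus {d : ℕ} (j k : Fin d) : Op d := ((1 / √2 : ℝ) : ℂ) • (E j k + E k j)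

/-- `E_{jk}^- = -i (|j⟩⟨k| - |k⟩⟨j|) / √2`. -/
def Eminus {d : ℕ} (j k : Fin d) : Op d := (-Complex.I * ((1 / √2 : ℝ) : ℂ)) • (E j k - E k j)

/-- The superoperator `|A⟩⟩⟨⟨B|`, i.e. `X ↦ tr(Bᴴ X) A`. -/
def dOuter {d : ℕ} (A B : Op d) : SuperOp d where
  toFun X := (Bᴴ * X).trace • A
  map_add' X Y := by rw [Matrix.mul_add, Matrix.trace_add, add_smul]
  map_smul' c X := by
    rw [Matrix.mul_smul, Matrix.trace_smul, smul_eq_mul, mul_smul, RingHom.id_apply]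

/-- Unit vectors of `ℂ^d`. -/
abbrev PureState (d : ℕ) : Type := Metric.sphere (0 : EuclideanSpace ℂ (Fin d)) 1

/-- The normalized (unitarily invariant) Haar measure on the unit vectors of `ℂ^d`. -/
def haarPure (d : ℕ) : Measure (PureState d) :=
  ((volume : Measure (EuclideanSpace ℂ (Fin d))).toSphere Set.univ)⁻¹ •
    (volume : Measure (EuclideanSpace ℂ (Fin d))).toSphere

/-- The projector `Π_ψ = |ψ⟩⟨ψ|`. -/
def ketbra {d : ℕ} (ψ : PureState d) : Op d :=
  Matrix.of fun i j => ψ.1 i * star (ψ.1 j)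

/-- `⟨ψ|ρ|ψ⟩ = tr(Π_ψ ρ)`. -/
def born {d : ℕ} (ρ : Op d) (ψ : PureState d) : ℝ := (ketbra ψ * ρ).trace.re

/-- The integral `∫ dμ(ψ) T(ψ)` of a superoperator-valued function over the pure states, computed
entrywise in the orthonormal operator basis `E_{jk}`. -/
def haarIntegral {d : ℕ} (T : PureState d → SuperOp d) : SuperOp d :=
  ∑ i, ∑ j, ∑ k, ∑ l, (∫ ψ, T ψ (E k l) i j ∂haarPure d) • dOuter (E i j) (E k l)

/-- The frame superoperator of the covariant measurement,
`F(ρ) = d ∫ dμ(ψ) ⟨ψ|ρ|ψ⟩⁻¹ |Π_ψ⟩⟩⟨⟨Π_ψ|`. -/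
def frame {d : ℕ} (ρ : Op d) : SuperOp d :=
  (d : ℂ) • haarIntegral fun ψ => (((born ρ ψ)⁻¹ : ℝ) : ℂ) • dOuter (ketbra ψ) (ketbra ψ)

/-- The projector `Ī` onto the traceless operators. -/
def tracelessProj (d : ℕ) : SuperOp d := 1 - ((d : ℂ)⁻¹) • dOuter 1 1

/-- The Fisher information superoperator `F̄(ρ) = Ī F(ρ) Ī`. -/
def fisher {d : ℕ} (ρ : Op d) : SuperOp d := tracelessProj d * frame ρ * tracelessProj d

/-- The scaled mean-square-error matrix of the linear estimator with reconstruction operators `Θ_ψ`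
for the covariant measurement, `d ∫ dμ(ψ) |Θ_ψ⟩⟩ ⟨ψ|ρ|ψ⟩ ⟨⟨Θ_ψ| - |ρ⟩⟩⟨⟨ρ|`. -/
def mseMatrix {d : ℕ} (ρ : Op d) (Θ : PureState d → Op d) : SuperOp d :=
  (d : ℂ) • haarIntegral (fun ψ => ((born ρ ψ : ℝ) : ℂ) • dOuter (Θ ψ) (Θ ψ)) - dOuter ρ ρ

/-- The optimal reconstruction operators `Θ_ψ = ⟨ψ|ρ|ψ⟩⁻¹ F(ρ)⁻¹ Π_ψ`. -/
def optRec {d : ℕ} (ρ : Op d) (ψ : PureState d) : Op d :=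
  (((born ρ ψ)⁻¹ : ℝ) : ℂ) • (Ring.inverse (frame ρ)) (ketbra ψ)

/-- The scaled mean-square-error matrix `C(ρ)` of the best linear unbiased estimator. -/
def blueMatrix {d : ℕ} (ρ : Op d) : SuperOp d := mseMatrix ρ (optRec ρ)

/-- The scaled weighted mean-square error `Tr(W C(ρ))` (`W` and `C(ρ)` are Hermitian, so that this
trace is real). -/
def scaledWMSE {d : ℕ} (W : SuperOp d) (ρ : Op d) : ℝ :=
  (LinearMap.trace ℂ (Op d) (W * blueMatrix ρ)).re

/-- The scaled mean-square error with respect to the Hilbert-Schmidt distance. -/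
def scaledMSE {d : ℕ} (ρ : Op d) : ℝ := scaledWMSE 1 ρ

/-- The weighting matrix of the Bures metric `D_B²(ρ, ρ + dρ) = tr(dρ G) / 2`, where `G` is the
solution of `ρ G + G ρ = dρ`. In an eigenbasis of `ρ` with eigenvalues `λ_j > 0` this is
`D_B²(ρ, ρ + dρ) = (1/2) ∑_{j,k} |⟨j|dρ|k⟩|² / (λ_j + λ_k)`. -/
def buresWeight {d : ℕ} (ρ : Op d) : SuperOp d :=
  (1 / 2 : ℂ) • Ring.inverse (LinearMap.mulLeft ℂ ρ + LinearMap.mulRight ℂ ρ)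

/-- The scaled mean-square Bures distance. -/
def scaledMSB {d : ℕ} (ρ : Op d) : ℝ := scaledWMSE (buresWeight ρ) ρ

/-- The real vector space of traceless Hermitian operators. -/
def tracelessHerm (d : ℕ) : Submodule ℝ (Op d) where
  carrier := {X | X.IsHermitian ∧ X.trace = 0}
  add_mem' hX hY := ⟨hX.1.add hY.1, by rw [Matrix.trace_add, hX.2, hY.2, add_zero]⟩
  zero_mem' := ⟨Matrix.isHermitian_zero, Matrix.trace_zero _ _⟩
  smul_mem' c X hX := ⟨by
    change (c • X)ᴴ = c • X
    rw [Matrix.conjTranspose_smul, hX.1.eq, star_trivial], by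
    rw [Matrix.trace_smul, hX.2, smul_zero]⟩

/-- The orthogonal projection `X ↦ (X + Xᴴ)/2 - (Re tr X / d) 1` onto the traceless Hermitian
operators. -/
def tracelessHermProj (d : ℕ) : Op d →ₗ[ℝ] tracelessHerm d where
  toFun X := ⟨(1 / 2 : ℝ) • (X + Xᴴ) - (X.trace.re / d) • (1 : Op d), by
    constructor
    · change (_ : Op d)ᴴ = _
      simp [Matrix.conjTranspose_smul, add_comm]
    · rcases Nat.eq_zero_or_pos d with rfl | hd
      · simp [Matrix.trace]
      · have hd' : (d : ℂ) ≠ 0 := by exact_mod_cast hd.ne'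
        rw [Matrix.trace_sub, Matrix.trace_smul, Matrix.trace_smul, Matrix.trace_add,
          Matrix.trace_conjTranspose, Matrix.trace_one, Fintype.card_fin]
        apply Complex.ext
        · have hd2 : (d : ℝ) ≠ 0 := by exact_mod_cast hd.ne'
          simp
          field_simp
          ring
        · simp⟩
  map_add' X Y := by
    apply Subtype.ext
    simp only [Submodule.coe_add, Matrix.conjTranspose_add, Matrix.trace_add, Complex.add_re,
      add_div, add_smul, smul_add]
    abel
  map_smul' c X := by
    apply Subtype.ext
    simp only [Submodule.coe_smul, Matrix.conjTranspose_smul, star_trivial, Matrix.trace_smul,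
      Complex.smul_re, smul_eq_mul, RingHom.id_apply, smul_sub, smul_add, smul_smul,
      mul_div_assoc, mul_comm]

/-- The restriction of a superoperator to the real space of traceless Hermitian operators (the
projection acts trivially if the superoperator leaves this space invariant). -/
def restrictTH {d : ℕ} (O : SuperOp d) : Module.End ℝ (tracelessHerm d) :=
  tracelessHermProj d ∘ₗ O.restrictScalars ℝ ∘ₗ (tracelessHerm d).subtype

/-- The volume `V_{d²-1}` of the unit ball of dimension `d² - 1`. -/
def ballVol (d : ℕ) : ℝ := Real.pi ^ (((d : ℝ) ^ 2 - 1) / 2) / Real.Gamma (((d : ℝ) ^ 2 + 1) / 2)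

/-- The volume of the scaled uncertainty ellipsoid, `V_{d²-1} √(Det C(ρ))`, with the determinant
taken on the traceless Hermitian operators. -/
def ellipsoidVol {d : ℕ} (ρ : Op d) : ℝ :=
  ballVol d * √(LinearMap.det (restrictTH (blueMatrix ρ)))

/-- `ρ_r(s) = (s/r) ∑_{j ≤ r} |j⟩⟨j| + (1-s)/d`; the `r` basis vectors are those of index `< r`
in `Fin d`. -/
def rhoState (d r : ℕ) (s : ℝ) : Op d :=
  ((s / r : ℝ) : ℂ) • (∑ j : Fin d with j.val < r, E j j) + (((1 - s) / d : ℝ) : ℂ) • (1 : Op d)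

/-- The integrals `g_{jk}`. -/
def g (d r : ℕ) (s : ℝ) (j k : ℕ) : ℝ :=
  2 * d * r * Real.Gamma (d + 1) / (Real.Gamma (r + j) * Real.Gamma ((d : ℝ) - r + k)) *
    ∫ α in (0 : ℝ)..(Real.pi / 2),
      Real.cos α ^ (2 * r - 1 + 2 * j) * Real.sin α ^ (2 * d - 2 * r - 1 + 2 * k) /
        (d * s * Real.cos α ^ 2 + r * (1 - s))

/-- `a = g_{20}`. -/
def aPar (d r : ℕ) (s : ℝ) : ℝ := g d r s 2 0

/-- `b = g_{11}`. -/
def bPar (d r : ℕ) (s : ℝ) : ℝ := g d r s 1 1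

/-- `c = g_{02}`. -/
def cPar (d r : ℕ) (s : ℝ) : ℝ := g d r s 0 2

/-- `β = ((r+1)(d-r) a + r(d-r+1) c - 2r(d-r) b) / d`. -/
def betaPar (d r : ℕ) (s : ℝ) : ℝ :=
  ((r + 1) * (d - r) * aPar d r s + r * (d - r + 1) * cPar d r s
    - 2 * r * (d - r) * bPar d r s) / d

/-- The projector onto the span of the `E_{jk}` with `j ≠ k` both in the first block. -/
def P1 (d r : ℕ) : SuperOp d :=
  ∑ j : Fin d, ∑ k : Fin d, if j ≠ k ∧ j.val < r ∧ k.val < r then dOuter (E j k) (E j k) else 0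

/-- The projector onto the span of the `E_{jk}`, `E_{kj}` with `j` in the first and `k` in the
second block. -/
def P2 (d r : ℕ) : SuperOp d :=
  ∑ j : Fin d, ∑ k : Fin d,
    if j.val < r ∧ r ≤ k.val then dOuter (E j k) (E j k) + dOuter (E k j) (E k j) else 0

/-- The projector onto the span of the `E_{jk}` with `j ≠ k` both in the second block. -/
def P3 (d r : ℕ) : SuperOp d :=
  ∑ j : Fin d, ∑ k : Fin d, if j ≠ k ∧ r ≤ j.val ∧ r ≤ k.val then dOuter (E j k) (E j k) else 0

/-- The common value `a`, `b` or `c` attached to a pair of indices by the blocks they lie in. -/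
def blockVal (d r : ℕ) (s : ℝ) (j k : Fin d) : ℝ :=
  if j.val < r ∧ k.val < r then aPar d r s
  else if r ≤ j.val ∧ r ≤ k.val then cPar d r s
  else bPar d r s

/-- The matrix `M`: `(1+δ_{jk}) a` on the first block, `(1+δ_{jk}) c` on the second block and `b`
elsewhere. -/
def Mmat (d r : ℕ) (s : ℝ) : Matrix (Fin d) (Fin d) ℝ :=
  Matrix.of fun j k => (1 + if j = k then 1 else 0) * blockVal d r s j k

/-- The `d × d` matrix of `Ī` on diagonal operators. -/
def Ibar (d : ℕ) : Matrix (Fin d) (Fin d) ℝ := 1 - (d : ℝ)⁻¹ • Matrix.of fun _ _ => 1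

/-- `M̄ = Ī M Ī`. -/
def Mbar (d r : ℕ) (s : ℝ) : Matrix (Fin d) (Fin d) ℝ := Ibar d * Mmat d r s * Ibar d

/-- `∑_{j,k} N_{jk} |E_{jj}⟩⟩⟨⟨E_{kk}|`. -/
def diagSuper {d : ℕ} (N : Matrix (Fin d) (Fin d) ℝ) : SuperOp d :=
  ∑ j, ∑ k, ((N j k : ℝ) : ℂ) • dOuter (E j j) (E k k)

/-- The larger eigenvalue `λ₁ = s/r + (1-s)/d` of `ρ_r(s)`. -/
def lam1 (d r : ℕ) (s : ℝ) : ℝ := s / r + (1 - s) / d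

/-- The smaller eigenvalue `λ₂ = (1-s)/d` of `ρ_r(s)`. -/
def lam2 (d : ℕ) (s : ℝ) : ℝ := (1 - s) / d

end CovTomo

end

noncomputable section

namespace CovTomo

/-! Since `ρ_r(s)` is diagonal with eigenvalues `λ_m`, the Born probability `p_ψ = ∑ λ_m |ψ_m|²` is
a quadratic form, and the entries of the frame superoperator are averages of degree-four monomials
in `ψ`, `ψ̄` against `1 / p_ψ`. Writing `1 / p = (d + 1) ∫ (1 + z p)^(-d-2) dz` and using `∑ |ψ_m|²
= 1` turns `1 + z p_ψ` into the form with weights `1 + z λ_m`. The power `d + 2` is the one for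
which a Gaussian integral over `ℂ^d` in polar coordinates evaluates the spherical average as a
product of one-mode moments (`integral_haarPure_monom`). An entry therefore vanishes unless the
exponents of `ψ` and `ψ̄` agree, and otherwise equals `∫ ∏ p_m! (1 + z λ_m)^(-p_m-1) dz`
(`integral_monom_inv_wForm`). These are the half-line integrals `hInt`; Feynman parametrization and
`x = cos² α` identify them with `a`, `b`, `c` (`g_eq_hInt`).

So the frame superoperator multiplies the off-diagonal `E_{jk}` by block constants and acts on the
diagonal by `M` (`frame_rhoState`). Products of such superoperators (`blockSuper`) reduce to
products of entries and of `d × d` matrices constant on blocks, up to diagonals (`bm`). Compressing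
`M` to vectors of zero sum gives eigenvalues `a`, `c`, `β` (`Mbar_eq`, `charpoly_specMat`); `β > 0`
follows from Cauchy–Schwarz, `b² ≤ a c`.

Integrating a total derivative gives `M λ = 𝟙`, that is, `F(ρ)` maps `ρ` to the identity. Hence the
inverse of the frame superoperator is the pseudoinverse of the Fisher superoperator plus `|ρ⟩⟩⟨⟨ρ|`
(`Mmat_mul_invMat`), and `C(ρ)` is that pseudoinverse (`blueMatrix_rhoState`). The MSE, the MSB and
the volume are then traces and a determinant. The limit `s → 1` is dominated convergence in `hInt`.
-/

/-! ### Gaussian moments on the complex plane. -/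

/-- The one-mode Gaussian moment integrand `z ^ p * conj z ^ q * exp (-b |z|²)`. -/
def gaussMon (p q : ℕ) (b : ℝ) (z : ℂ) : ℂ :=
  z ^ p * star z ^ q * ((Real.exp (-b * ‖z‖ ^ 2) : ℝ) : ℂ)

lemma continuous_gaussMon (p q : ℕ) (b : ℝ) : Continuous (gaussMon p q b) := by
  unfold gaussMon
  fun_prop

lemma integrable_gaussMon (p q : ℕ) {b : ℝ} (hb : 0 < b) : Integrable (gaussMon p q b) := by
  have h := (integrable_fun_norm_addHaar (E := ℂ) volume
    (f := fun t : ℝ => t ^ (p + q) * Real.exp (-b * t ^ 2))).2 (by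
      have := integrableOn_rpow_mul_exp_neg_mul_sq hb (s := ((p + q + 1 : ℕ) : ℝ))
        (by linarith [show (0 : ℝ) ≤ ((p + q + 1 : ℕ) : ℝ) by positivity])
      refine this.congr_fun (fun t _ => ?_) measurableSet_Ioi
      simp only [Real.rpow_natCast, Complex.finrank_real_complex, smul_eq_mul]
      ring)
  refine h.mono' (continuous_gaussMon p q b).aestronglyMeasurable (Eventually.of_forall fun z => ?_)
  rw [gaussMon, norm_mul, norm_mul, norm_pow, norm_pow, norm_star, Complex.norm_real,
    Real.norm_eq_abs, abs_of_pos (Real.exp_pos _), pow_add]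

/-- Rotation by the angle `π / (p - q)` preserves Lebesgue measure and multiplies the integrand by
`-1`. -/
lemma integral_gaussMon_of_ne {p q : ℕ} (hpq : p ≠ q) (b : ℝ) :
    ∫ z, gaussMon p q b z = 0 := by
  have hne : (p : ℂ) - q ≠ 0 := sub_ne_zero.2 (by exact_mod_cast hpq)
  let θ : ℝ := Real.pi / ((p : ℝ) - q)
  have hc : (Circle.exp θ : ℂ) ^ p * star (Circle.exp θ : ℂ) ^ q = -1 := by
    rw [← Complex.exp_pi_mul_I, Circle.coe_exp]
    have : star (Complex.exp (θ * Complex.I)) = Complex.exp (-(θ * Complex.I)) := by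
      rw [Complex.star_def, ← Complex.exp_conj]; simp
    rw [this, ← Complex.exp_nat_mul, ← Complex.exp_nat_mul, ← Complex.exp_add]
    congr 1
    simp only [θ]
    push_cast
    field_simp
    ring
  have h := (rotation (Circle.exp θ)).measurePreserving.integral_comp
    (rotation (Circle.exp θ)).toHomeomorph.measurableEmbedding (gaussMon p q b)
  have h2 : ∀ z, gaussMon p q b (rotation (Circle.exp θ) z) = - gaussMon p q b z := by
    intro z
    have hn : ‖(rotation (Circle.exp θ)) z‖ = ‖z‖ := LinearIsometryEquiv.norm_map _ _
    rw [gaussMon, hn, rotation_apply, star_mul', mul_pow, mul_pow, gaussMon]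
    linear_combination (z ^ p * star z ^ q * ((Real.exp (-b * ‖z‖ ^ 2) : ℝ) : ℂ)) * hc
  simp only [h2, integral_neg] at h
  exact self_eq_neg.1 h.symm

lemma integral_gaussMon_self (p : ℕ) {b : ℝ} (hb : 0 < b) :
    ∫ z, gaussMon p p b z = ((Real.pi * p.factorial / b ^ (p + 1) : ℝ) : ℂ) := by
  have h := Complex.integral_rpow_mul_exp_neg_mul_rpow (p := 2) (q := ((2 * p : ℕ) : ℝ)) (b := b)
    (by norm_num) (by push_cast; linarith [show (0 : ℝ) ≤ p by positivity]) hb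
  have e : ∀ z : ℂ, gaussMon p p b z
      = ((‖z‖ ^ ((2 * p : ℕ) : ℝ) * Real.exp (-b * ‖z‖ ^ (2 : ℝ)) : ℝ) : ℂ) := by
    intro z
    rw [gaussMon, ← mul_pow, Complex.star_def, Complex.mul_conj, Complex.normSq_eq_norm_sq,
      Real.rpow_natCast, Real.rpow_two, pow_mul]
    push_cast
    rfl
  simp_rw [e]
  rw [integral_complex_ofReal, h]
  congr 1
  have e1 : (((2 * p : ℕ) : ℝ) + 2) / 2 = (p : ℝ) + 1 := by push_cast; ring
  rw [neg_div, e1, Real.Gamma_nat_eq_factorial, Real.rpow_neg hb.le]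
  rw [show ((p : ℝ) + 1) = ((p + 1 : ℕ) : ℝ) by push_cast; ring, Real.rpow_natCast]
  field_simp

lemma integral_gaussMon (p q : ℕ) {b : ℝ} (hb : 0 < b) :
    ∫ z, gaussMon p q b z =
      if p = q then ((Real.pi * p.factorial / b ^ (p + 1) : ℝ) : ℂ) else 0 := by
  split_ifs with h
  · subst h; exact integral_gaussMon_self p hb
  · exact integral_gaussMon_of_ne h b

/-! ### Polar coordinates and moments of the invariant measure on the unit sphere. -/

/-- Integration in polar coordinates. -/
lemma integral_eq_integral_toSphere {E : Type*} [NormedAddCommGroup E] [NormedSpace ℝ E]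
    [MeasurableSpace E] [BorelSpace E] [FiniteDimensional ℝ E] [Nontrivial E]
    (μ : Measure E) [μ.IsAddHaarMeasure] {f : E → ℂ} (hf : Integrable f μ) :
    ∫ x, f x ∂μ = ∫ ω : Metric.sphere (0 : E) 1, (∫ t in Set.Ioi (0 : ℝ),
      ((t ^ (Module.finrank ℝ E - 1) : ℝ) : ℂ) * f (t • (ω : E))) ∂μ.toSphere := by
  have hmp := μ.measurePreserving_homeomorphUnitSphereProd
  have hemb := (homeomorphUnitSphereProd E).measurableEmbedding
  let G : (Metric.sphere (0 : E) 1) × (Set.Ioi (0 : ℝ)) → ℂ := fun y => f (y.2.1 • (y.1 : E))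
  have hG : ∀ x : ({0}ᶜ : Set E), G (homeomorphUnitSphereProd E x) = f x := by
    intro x
    have hx : ‖(x : E)‖ ≠ 0 := norm_ne_zero_iff.2 x.2
    simp [G, smul_smul, hx]
  have h1 : ∫ x, f x ∂μ = ∫ y, G y ∂(μ.toSphere.prod (.volumeIoiPow (Module.finrank ℝ E - 1))) := by
    rw [← hmp.integral_comp hemb]
    simp_rw [hG]
    rw [integral_subtype_comap (measurableSet_singleton _).compl, restrict_compl_singleton]
  have hint : Integrable G (μ.toSphere.prod (.volumeIoiPow (Module.finrank ℝ E - 1))) := by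
    rw [← hmp.integrable_comp_emb hemb]
    have : (G ∘ (homeomorphUnitSphereProd E)) = f ∘ ((↑) : ({0}ᶜ : Set E) → E) := funext hG
    rw [this, ← integrableOn_iff_comap_subtypeVal (measurableSet_singleton _).compl]
    exact hf.integrableOn
  rw [h1, integral_prod _ hint]
  congr 1
  funext ω
  simp only [Measure.volumeIoiPow, ENNReal.ofReal, G]
  rw [integral_withDensity_eq_integral_smul,
    integral_subtype_comap measurableSet_Ioi
      fun a : ℝ ↦ Real.toNNReal (a ^ (Module.finrank ℝ E - 1)) • f (a • (ω : E)),
    setIntegral_congr_fun measurableSet_Ioi fun x hx ↦ ?_]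
  · simp only [NNReal.smul_def]
    rw [Real.coe_toNNReal _ (pow_nonneg (le_of_lt hx) _), Complex.real_smul]
  · exact (measurable_subtype_coe.pow_const _).real_toNNReal

/-- Lebesgue measure on `ℂ^d` with the Euclidean norm is a multiple of the product measure. -/
lemma exists_integral_euclidean_eq (d : ℕ) : ∃ C : ℝ,
    (∀ f : EuclideanSpace ℂ (Fin d) → ℂ,
      ∫ x, f x = C * ∫ y : Fin d → ℂ, f (WithLp.toLp 2 y)) ∧
    (∀ f : EuclideanSpace ℂ (Fin d) → ℂ,
      Integrable (fun y : Fin d → ℂ => f (WithLp.toLp 2 y)) → Integrable f) := by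
  let e : (Fin d → ℂ) ≃L[ℝ] EuclideanSpace ℂ (Fin d) :=
    (PiLp.continuousLinearEquiv 2 ℝ (fun _ : Fin d => ℂ)).symm
  have hmeas : MeasurableEmbedding e := e.toHomeomorph.measurableEmbedding
  have : (Measure.map e (volume : Measure (Fin d → ℂ))).IsAddHaarMeasure :=
    e.isAddHaarMeasure_map volume
  -- Uniqueness of Haar measure yields some constant; its value is irrelevant, because normalization
  -- cancels it.
  obtain ⟨c, hs⟩ : ∃ c : NNReal, (volume : Measure (EuclideanSpace ℂ (Fin d)))
      = c • Measure.map e (volume : Measure (Fin d → ℂ)) :=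
    ⟨_, Measure.isAddLeftInvariant_eq_smul _ _⟩
  refine ⟨c, fun f => ?_, fun f hf => ?_⟩
  rotate_left
  · rw [hs]
    refine Integrable.smul_measure_nnreal ?_
    exact (hmeas.integrable_map_iff).2 hf
  · rw [hs, integral_smul_nnreal_measure, hmeas.integral_map, NNReal.smul_def, Complex.real_smul]
    rfl

lemma integral_pow_mul_exp_neg_mul_sq (n : ℕ) {b : ℝ} (hb : 0 < b) :
    ∫ t in Set.Ioi (0 : ℝ), t ^ (2 * n + 1) * Real.exp (-b * t ^ 2)
      = n.factorial / (2 * b ^ (n + 1)) := by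
  have h := integral_rpow_mul_exp_neg_mul_rpow (p := 2) (q := ((2 * n + 1 : ℕ) : ℝ)) (b := b)
    (by norm_num) (by push_cast; linarith [show (0 : ℝ) ≤ n by positivity]) hb
  simp only [Real.rpow_natCast, Real.rpow_two] at h
  rw [h]
  have e1 : (((2 * n + 1 : ℕ) : ℝ) + 1) / 2 = (n : ℝ) + 1 := by push_cast; ring
  rw [neg_div, e1, Real.Gamma_nat_eq_factorial, Real.rpow_neg hb.le]
  rw [show ((n : ℝ) + 1) = ((n + 1 : ℕ) : ℝ) by push_cast; ring, Real.rpow_natCast]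
  field_simp

/-- The monomial `∏ x_m ^ p_m * conj x_m ^ q_m`. -/
def monom {d : ℕ} (p q : Fin d → ℕ) (x : EuclideanSpace ℂ (Fin d)) : ℂ :=
  ∏ m, (x m ^ p m * star (x m) ^ q m)

/-- The weighted quadratic form `∑ w_m |x_m|²`. -/
def wForm {d : ℕ} (w : Fin d → ℝ) (x : EuclideanSpace ℂ (Fin d)) : ℝ := ∑ m, w m * ‖x m‖ ^ 2

lemma continuous_monom {d : ℕ} (p q : Fin d → ℕ) : Continuous (monom p q) := by
  unfold monom
  fun_prop

lemma continuous_wForm {d : ℕ} (w : Fin d → ℝ) : Continuous (wForm w) := by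
  unfold wForm
  fun_prop

lemma sum_norm_sq_sphere {d : ℕ} (ω : PureState d) : ∑ m, ‖ω.1 m‖ ^ 2 = 1 := by
  have h : ‖ω.1‖ = 1 := by simp
  rw [← EuclideanSpace.norm_sq_eq, h, one_pow]

lemma le_wForm_sphere {d : ℕ} {w : Fin d → ℝ} {c : ℝ} (hw : ∀ m, c ≤ w m) (ω : PureState d) :
    c ≤ wForm w ω.1 := by
  calc c = ∑ m, c * ‖ω.1 m‖ ^ 2 := by rw [← Finset.mul_sum, sum_norm_sq_sphere, mul_one]
    _ ≤ _ := Finset.sum_le_sum fun m _ => mul_le_mul_of_nonneg_right (hw m) (by positivity)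

lemma wForm_pos_sphere {d : ℕ} {w : Fin d → ℝ} (hw : ∀ m, 0 < w m) (ω : PureState d) :
    0 < wForm w ω.1 := by
  refine lt_of_le_of_ne (le_wForm_sphere (fun m => (hw m).le) ω) fun h => ?_
  have h0 := (Finset.sum_eq_zero_iff_of_nonneg
    (fun m _ => mul_nonneg (hw m).le (by positivity))).1 h.symm
  have h1 := sum_norm_sq_sphere ω
  rw [Finset.sum_eq_zero] at h1
  · exact zero_ne_one h1
  · intro m hm
    exact (mul_eq_zero.1 (h0 m hm)).resolve_left (hw m).ne'

lemma monom_smul {d : ℕ} (p q : Fin d → ℕ) (t : ℝ) (x : EuclideanSpace ℂ (Fin d)) :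
    monom p q (t • x) = ((t ^ ∑ m, (p m + q m) : ℝ) : ℂ) * monom p q x := by
  unfold monom
  rw [← Finset.prod_pow_eq_pow_sum, Complex.ofReal_prod, ← Finset.prod_mul_distrib]
  refine Finset.prod_congr rfl fun m _ => ?_
  simp only [PiLp.smul_apply, Complex.real_smul, star_mul', Complex.star_def, Complex.conj_ofReal]
  push_cast
  ring

lemma wForm_smul {d : ℕ} (w : Fin d → ℝ) (t : ℝ) (x : EuclideanSpace ℂ (Fin d)) :
    wForm w (t • x) = wForm w x * t ^ 2 := by
  unfold wForm
  rw [Finset.sum_mul]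
  refine Finset.sum_congr rfl fun m _ => ?_
  simp only [PiLp.smul_apply, norm_smul, mul_pow, Real.norm_eq_abs, sq_abs]
  ring

lemma monom_mul_exp_wForm {d : ℕ} (p q : Fin d → ℕ) (w : Fin d → ℝ)
    (x : EuclideanSpace ℂ (Fin d)) :
    monom p q x * ((Real.exp (-wForm w x) : ℝ) : ℂ) = ∏ m, gaussMon (p m) (q m) (w m) (x m) := by
  unfold monom wForm gaussMon
  rw [← Finset.sum_neg_distrib, Real.exp_sum, Complex.ofReal_prod, ← Finset.prod_mul_distrib]
  simp_rw [neg_mul]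

/-- Gaussian integration in polar coordinates of a monomial of degree `2k` over `ℂ^d`. -/
lemma exists_integral_toSphere_monom {d : ℕ} (hd : 0 < d) : ∃ C : ℝ,
    ∀ (p q : Fin d → ℕ) (k : ℕ) (w : Fin d → ℝ), (∀ m, 0 < w m) → ∑ m, (p m + q m) = 2 * k →
      ((d + k - 1).factorial : ℂ) * ∫ ω : PureState d, monom p q ω.1 *
          (((wForm w ω.1 ^ (d + k))⁻¹ : ℝ) : ℂ)
          ∂(volume : Measure (EuclideanSpace ℂ (Fin d))).toSphere
        = C * ∏ m, if p m = q m then (((p m).factorial / w m ^ (p m + 1) : ℝ) : ℂ) else 0 := by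
  obtain ⟨C, hC, hCi⟩ := exists_integral_euclidean_eq d
  have : Nonempty (Fin d) := ⟨⟨0, hd⟩⟩
  -- The factor `2` comes from the radial integral `(d + k - 1)! / (2 b ^ (d + k))`, and `π ^ d`
  -- from the `d` one-mode moments.
  refine ⟨2 * (C * Real.pi ^ d), fun p q k w hw hk => ?_⟩
  have hint : Integrable fun x => monom p q x * ((Real.exp (-wForm w x) : ℝ) : ℂ) := by
    refine hCi _ ?_
    simp_rw [monom_mul_exp_wForm]
    exact Integrable.fintype_prod fun m => integrable_gaussMon (p m) (q m) (hw m)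
  have h2 : ∫ y : Fin d → ℂ, monom p q (WithLp.toLp 2 y) *
        ((Real.exp (-wForm w (WithLp.toLp 2 y)) : ℝ) : ℂ)
      = ∏ m, ∫ z, gaussMon (p m) (q m) (w m) z := by
    simp_rw [monom_mul_exp_wForm]
    exact integral_fintype_prod_volume_eq_prod (fun m => gaussMon (p m) (q m) (w m))
  have h1 := (hC _).symm.trans (integral_eq_integral_toSphere _ hint)
  rw [h2] at h1
  simp_rw [monom_smul, wForm_smul, hk,
    fun m => integral_gaussMon (p m) (q m) (hw m)] at h1
  have hdim : Module.finrank ℝ (EuclideanSpace ℂ (Fin d)) = 2 * d := by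
    rw [← Module.finrank_mul_finrank ℝ ℂ, finrank_euclideanSpace_fin, Complex.finrank_real_complex]
  have h3 : ∀ ω : PureState d, ∫ t in Set.Ioi (0 : ℝ),
      ((t ^ (Module.finrank ℝ (EuclideanSpace ℂ (Fin d)) - 1) : ℝ) : ℂ) *
        (((t ^ (2 * k) : ℝ) : ℂ) * monom p q ω.1 *
          ((Real.exp (-(wForm w ω.1 * t ^ 2)) : ℝ) : ℂ))
      = ((d + k - 1).factorial / 2 : ℂ) *
        (monom p q ω.1 * (((wForm w ω.1 ^ (d + k))⁻¹ : ℝ) : ℂ)) := by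
    intro ω
    have hq := wForm_pos_sphere hw ω
    have e : ∀ t : ℝ, ((t ^ (Module.finrank ℝ (EuclideanSpace ℂ (Fin d)) - 1) : ℝ) : ℂ) *
        (((t ^ (2 * k) : ℝ) : ℂ) * monom p q ω.1 *
          ((Real.exp (-(wForm w ω.1 * t ^ 2)) : ℝ) : ℂ))
        = monom p q ω.1 *
          ((t ^ (2 * (d + k - 1) + 1) * Real.exp (-wForm w ω.1 * t ^ 2) : ℝ) : ℂ) := by
      intro t
      rw [hdim, show 2 * (d + k - 1) + 1 = (2 * d - 1) + 2 * k by omega, pow_add, neg_mul]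
      push_cast
      ring
    simp_rw [e]
    rw [integral_const_mul, integral_complex_ofReal, integral_pow_mul_exp_neg_mul_sq _ hq,
      show d + k - 1 + 1 = d + k by omega]
    push_cast
    field_simp
  simp_rw [h3] at h1
  rw [integral_const_mul] at h1
  have h4 : (∏ m, if p m = q m then
        ((Real.pi * (p m).factorial / w m ^ (p m + 1) : ℝ) : ℂ) else 0)
      = (Real.pi : ℂ) ^ d *
        ∏ m, if p m = q m then (((p m).factorial / w m ^ (p m + 1) : ℝ) : ℂ) else 0 := by
    rw [show (Real.pi : ℂ) ^ d = ∏ _m : Fin d, (Real.pi : ℂ) by simp, ← Finset.prod_mul_distrib]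
    refine Finset.prod_congr rfl fun m _ => ?_
    split_ifs
    · push_cast; ring
    · simp
  rw [h4] at h1
  push_cast
  push_cast at h1
  linear_combination (-2) * h1

lemma haarPure_eq (d : ℕ) (f : PureState d → ℂ) :
    ∫ ω, f ω ∂haarPure d =
      (((volume : Measure (EuclideanSpace ℂ (Fin d))).toSphere.real Set.univ)⁻¹ : ℝ) *
        ∫ ω, f ω ∂(volume : Measure (EuclideanSpace ℂ (Fin d))).toSphere := by
  rw [haarPure, integral_smul_measure, ENNReal.toReal_inv, Complex.real_smul, Measure.real]

lemma isProbabilityMeasure_haarPure {d : ℕ} (hd : 0 < d) : IsProbabilityMeasure (haarPure d) := by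
  have : Nonempty (Fin d) := ⟨⟨0, hd⟩⟩
  have h := Measure.toSphere_ne_zero (volume : Measure (EuclideanSpace ℂ (Fin d)))
  exact ⟨by
    rw [haarPure, Measure.smul_apply, smul_eq_mul]
    exact ENNReal.inv_mul_cancel (by rwa [ne_eq, Measure.measure_univ_eq_zero]) (measure_ne_top _ _)⟩

/-- The moments of the normalized invariant measure against a power of a quadratic form. -/
theorem integral_haarPure_monom {d : ℕ} (hd : 0 < d) (p q : Fin d → ℕ) (k : ℕ) (w : Fin d → ℝ)
    (hw : ∀ m, 0 < w m) (hk : ∑ m, (p m + q m) = 2 * k) :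
    ((d + k - 1).factorial : ℂ) * ∫ ω : PureState d, monom p q ω.1 *
        (((wForm w ω.1 ^ (d + k))⁻¹ : ℝ) : ℂ) ∂haarPure d
      = (d - 1).factorial *
        ∏ m, if p m = q m then (((p m).factorial / w m ^ (p m + 1) : ℝ) : ℂ) else 0 := by
  obtain ⟨C, hC⟩ := exists_integral_toSphere_monom hd
  have : Nonempty (Fin d) := ⟨⟨0, hd⟩⟩
  -- The trivial monomial with unit weights expresses the unknown constant through the total mass of
  -- the sphere.
  have h0 := hC (fun _ => 0) (fun _ => 0) 0 (fun _ => 1) (fun _ => one_pos) (by simp)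
  have h1 : ∀ ω : PureState d, wForm (fun _ => 1) ω.1 = 1 := fun ω => by
    simp only [wForm, one_mul, sum_norm_sq_sphere]
  simp only [monom, h1, pow_zero, mul_one, one_pow, inv_one, Complex.ofReal_one,
    Finset.prod_const_one, integral_const, add_zero, if_true, Nat.factorial_zero, Nat.cast_one,
    div_one] at h0
  have hne : (volume : Measure (EuclideanSpace ℂ (Fin d))).toSphere.real Set.univ ≠ 0 := by
    rw [Measure.real, ENNReal.toReal_ne_zero]
    exact ⟨by
      rw [ne_eq, Measure.measure_univ_eq_zero]
      exact Measure.toSphere_ne_zero (volume : Measure (EuclideanSpace ℂ (Fin d))),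
      measure_ne_top _ _⟩
  have hne' : (((volume : Measure (EuclideanSpace ℂ (Fin d))).toSphere.real Set.univ : ℝ) : ℂ) ≠ 0 :=
    by exact_mod_cast hne
  rw [Complex.real_smul, mul_one] at h0
  rw [haarPure_eq, mul_left_comm, hC p q k w hw hk, ← h0]
  push_cast
  field_simp

/-! ### Reciprocals as integrals of inverse powers. -/

lemma hasDerivAt_inv_linear_pow (l : ℝ) (k : ℕ) {z : ℝ} (hz : 0 < 1 + z * l) (hl : l ≠ 0) :
    HasDerivAt (fun z : ℝ => -(((k : ℝ) + 1) * l)⁻¹ * ((1 + z * l) ^ (k + 1))⁻¹)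
      (((1 + z * l) ^ (k + 2))⁻¹) z := by
  have h1 : HasDerivAt (fun z : ℝ => 1 + z * l) l z := by
    simpa using ((hasDerivAt_id z).mul_const l).const_add 1
  have h2 := ((h1.fun_pow (k + 1)).fun_inv (pow_pos hz _).ne').const_mul (-(((k : ℝ) + 1) * l)⁻¹)
  refine h2.congr_deriv ?_
  have : (k : ℝ) + 1 ≠ 0 := by positivity
  rw [Nat.add_sub_cancel]
  push_cast
  generalize 1 + z * l = D at hz
  field_simp
  ring

lemma tendsto_inv_linear_pow {l : ℝ} (hl : 0 < l) (k : ℕ) :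
    Tendsto (fun z : ℝ => ((1 + z * l) ^ (k + 1))⁻¹) atTop (𝓝 0) := by
  have h : Tendsto (fun z : ℝ => 1 + z * l) atTop atTop :=
    tendsto_atTop_add_const_left _ _ (tendsto_id.atTop_mul_const hl)
  exact tendsto_inv_atTop_zero.comp ((tendsto_pow_atTop (Nat.succ_ne_zero k)).comp h)

lemma integrableOn_inv_linear_pow {l : ℝ} (hl : 0 < l) (k : ℕ) :
    IntegrableOn (fun z : ℝ => ((1 + z * l) ^ (k + 2))⁻¹) (Set.Ioi 0) := by
  refine integrableOn_Ioi_deriv_of_nonneg' (l := 0)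
    (fun z (hz : 0 ≤ z) => hasDerivAt_inv_linear_pow l k (by positivity) hl.ne') ?_ ?_
  · intro z (hz : 0 < z); positivity
  · simpa using (tendsto_inv_linear_pow hl k).const_mul (-(((k : ℝ) + 1) * l)⁻¹)

lemma integral_inv_linear_pow {l : ℝ} (hl : 0 < l) (k : ℕ) :
    ∫ z in Set.Ioi (0 : ℝ), ((1 + z * l) ^ (k + 2))⁻¹ = (((k : ℝ) + 1) * l)⁻¹ := by
  rw [integral_Ioi_of_hasDerivAt_of_nonneg' (l := 0)
    (fun z (hz : 0 ≤ z) => hasDerivAt_inv_linear_pow l k (by positivity) hl.ne')]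
  · simp
  · intro z (hz : 0 < z); positivity
  · simpa using (tendsto_inv_linear_pow hl k).const_mul (-(((k : ℝ) + 1) * l)⁻¹)

/-- Writing `1 / p = (k + 1) ∫ (1 + z p) ^ (-k - 2) dz` under an integral sign. -/
lemma integral_integral_inv_linear_pow {Ω F : Type*} [MeasurableSpace Ω] {μ : Measure Ω}
    [IsFiniteMeasure μ] [NormedAddCommGroup F] [NormedSpace ℝ F] [CompleteSpace F] {p : Ω → ℝ}
    (hp : Measurable p) {l : ℝ} (hl : 0 < l) (hlp : ∀ᵐ ω ∂μ, l ≤ p ω) {M : Ω → F}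
    (hM : Integrable M μ) (k : ℕ) :
    ∫ z in Set.Ioi (0 : ℝ), ∫ ω, ((1 + z * p ω) ^ (k + 2))⁻¹ • M ω ∂μ
      = ((k : ℝ) + 1)⁻¹ • ∫ ω, (p ω)⁻¹ • M ω ∂μ := by
  have hint : Integrable (fun y : ℝ × Ω => ((1 + y.1 * p y.2) ^ (k + 2))⁻¹ • M y.2)
      ((volume.restrict (Set.Ioi (0 : ℝ))).prod μ) := by
    -- The lower bound `l ≤ p` separates the variables in the majorant, which justifies Fubini.
    have hb : Integrable (fun y : ℝ × Ω => ((1 + y.1 * l) ^ (k + 2))⁻¹ * ‖M y.2‖)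
        ((volume.restrict (Set.Ioi (0 : ℝ))).prod μ) :=
      Integrable.mul_prod (integrableOn_inv_linear_pow hl k) hM.norm
    have hmeas : Measurable fun y : ℝ × Ω => ((1 + y.1 * p y.2) ^ (k + 2))⁻¹ := by fun_prop
    refine hb.mono' (hmeas.aestronglyMeasurable.smul hM.aestronglyMeasurable.comp_snd) ?_
    have h1 : ∀ᵐ y ∂((volume.restrict (Set.Ioi (0 : ℝ))).prod μ), y.1 ∈ Set.Ioi (0 : ℝ) :=
      Measure.quasiMeasurePreserving_fst.ae (ae_restrict_mem measurableSet_Ioi)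
    have h2 : ∀ᵐ y ∂((volume.restrict (Set.Ioi (0 : ℝ))).prod μ), l ≤ p y.2 :=
      Measure.quasiMeasurePreserving_snd.ae hlp
    filter_upwards [h1, h2] with y hy1 hy2
    have hy1' : 0 < y.1 := hy1
    have hpos : 0 < 1 + y.1 * l := by positivity
    have hle : 1 + y.1 * l ≤ 1 + y.1 * p y.2 := by gcongr
    have hpos' := hpos.trans_le hle
    rw [norm_smul, Real.norm_eq_abs, abs_of_pos (by positivity)]
    gcongr
  rw [integral_integral_swap hint, ← integral_smul]
  refine integral_congr_ae ?_
  filter_upwards [hlp] with ω hω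
  rw [integral_smul_const, integral_inv_linear_pow (hl.trans_le hω), mul_inv, smul_smul]

/-! ### Feynman parametrization and the `g_{jk}` as half-line integrals. -/

lemma integral_pow_mul_one_sub_pow (m n : ℕ) :
    ∫ x in (0 : ℝ)..1, x ^ m * (1 - x) ^ n
      = m.factorial * n.factorial / (m + n + 1).factorial := by
  have h := Complex.betaIntegral_eq_Gamma_mul_div ((m : ℂ) + 1) ((n : ℂ) + 1)
    (by simp; positivity) (by simp; positivity)
  rw [Complex.betaIntegral, Complex.Gamma_nat_eq_factorial, Complex.Gamma_nat_eq_factorial,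
    show (m : ℂ) + 1 + (n + 1) = ((m + n + 1 : ℕ) : ℂ) + 1 by push_cast; ring,
    Complex.Gamma_nat_eq_factorial] at h
  simp only [add_sub_cancel_right, Complex.cpow_natCast] at h
  have e : ∀ x : ℝ, (x : ℂ) ^ m * (1 - (x : ℂ)) ^ n = ((x ^ m * (1 - x) ^ n : ℝ) : ℂ) := by
    intro x; push_cast; rfl
  simp_rw [e] at h
  rw [intervalIntegral.integral_ofReal] at h
  apply Complex.ofReal_injective
  rw [h]
  push_cast
  rfl

/-- Feynman parametrization. -/
lemma integral_feynman (m n : ℕ) {A C : ℝ} (hA : 0 < A) (hC : 0 < C) :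
    ∫ x in (0 : ℝ)..1, x ^ m * (1 - x) ^ n * ((x * A + (1 - x) * C) ^ (m + n + 2))⁻¹
      = m.factorial * n.factorial / (m + n + 1).factorial * (A ^ (m + 1) * C ^ (n + 1))⁻¹ := by
  have hD : ∀ x ∈ Set.uIcc (0 : ℝ) 1, 0 < x * A + (1 - x) * C := by
    intro x hx
    rw [Set.uIcc_of_le zero_le_one] at hx
    rcases eq_or_lt_of_le hx.1 with h | h
    · simp [← h, hC]
    · have := mul_pos h hA
      have := mul_nonneg (sub_nonneg.2 hx.2) hC.le
      linarith
  -- The substitution `y = x A / (x A + (1 - x) C)` maps `[0, 1]` onto itself and reduces the claim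
  -- to the Beta integral.
  have hder : ∀ x ∈ Set.uIcc (0 : ℝ) 1, HasDerivAt (fun x => x * A / (x * A + (1 - x) * C))
      (A * C * ((x * A + (1 - x) * C) ^ 2)⁻¹) x := by
    intro x hx
    have h1 : HasDerivAt (fun x : ℝ => x * A) A x := by
      simpa using (hasDerivAt_id x).mul_const A
    have h2 : HasDerivAt (fun x : ℝ => x * A + (1 - x) * C) (A + -C) x := by
      refine h1.add ?_
      simpa using ((hasDerivAt_id x).const_sub 1).mul_const C
    refine (h1.fun_div h2 (hD x hx).ne').congr_deriv ?_
    rw [div_eq_mul_inv]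
    ring
  have h := intervalIntegral.integral_comp_mul_deriv hder
    (ContinuousOn.mul continuousOn_const (ContinuousOn.inv₀ (by fun_prop)
      fun x hx => (pow_pos (hD x hx) 2).ne'))
    (g := fun y : ℝ => y ^ m * (1 - y) ^ n) (by fun_prop)
  simp only [zero_mul, zero_div, one_mul, sub_self, add_zero, div_self hA.ne',
    integral_pow_mul_one_sub_pow] at h
  rw [← h, mul_comm, ← intervalIntegral.integral_const_mul]
  refine intervalIntegral.integral_congr fun x hx => ?_
  have := (hD x hx).ne'
  have e : 1 - x * A / (x * A + (1 - x) * C) = (1 - x) * C / (x * A + (1 - x) * C) := by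
    field_simp
    ring
  simp only [Function.comp]
  rw [e, div_pow, div_pow, mul_pow, mul_pow]
  generalize x * A + (1 - x) * C = D at this
  field_simp
  ring

/-- The integral `∫ (1 + l₁ z) ^ (-m) (1 + l₂ z) ^ (-n) dz` over the half line. -/
def hInt (l₁ l₂ : ℝ) (m n : ℕ) : ℝ :=
  ∫ z in Set.Ioi (0 : ℝ), ((1 + z * l₁) ^ m * (1 + z * l₂) ^ n)⁻¹

lemma hInt_comm (l₁ l₂ : ℝ) (m n : ℕ) : hInt l₁ l₂ m n = hInt l₂ l₁ n m := by
  simp only [hInt, mul_comm]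

/-- Feynman's formula with `A = 1 + z l₁`, `C = 1 + z l₂` merges both factors into one power of `1 +
z (x l₁ + (1 - x) l₂)`. After exchanging the integrals, the one over `z` is elementary; the convex
combination stays above `min l₁ l₂`. -/
lemma hInt_eq_integral {l₁ l₂ : ℝ} (h₁ : 0 < l₁) (h₂ : 0 < l₂) (m n : ℕ) :
    hInt l₁ l₂ (m + 1) (n + 1) = (m + n).factorial / (m.factorial * n.factorial) *
      ∫ x in (0 : ℝ)..1, (x * l₁ + (1 - x) * l₂)⁻¹ * (x ^ m * (1 - x) ^ n) := by
  have hf : ∀ z ∈ Set.Ioi (0 : ℝ), ((1 + z * l₁) ^ (m + 1) * (1 + z * l₂) ^ (n + 1))⁻¹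
      = (m + n + 1).factorial / (m.factorial * n.factorial) *
        ∫ x in Set.Ioc (0 : ℝ) 1, ((1 + z * (x * l₁ + (1 - x) * l₂)) ^ (m + n + 2))⁻¹ •
          (x ^ m * (1 - x) ^ n) := by
    intro z (hz : 0 < z)
    have h := integral_feynman m n (A := 1 + z * l₁) (C := 1 + z * l₂) (by positivity)
      (by positivity)
    rw [intervalIntegral.integral_of_le zero_le_one] at h
    have e : ∀ x : ℝ, ((1 + z * (x * l₁ + (1 - x) * l₂)) ^ (m + n + 2))⁻¹ • (x ^ m * (1 - x) ^ n)
        = x ^ m * (1 - x) ^ n * ((x * (1 + z * l₁) + (1 - x) * (1 + z * l₂)) ^ (m + n + 2))⁻¹ := by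
      intro x
      rw [smul_eq_mul, mul_comm]
      congr 3
      ring
    simp_rw [e]
    rw [h]
    have := Nat.factorial_ne_zero m
    have := Nat.factorial_ne_zero n
    have := Nat.factorial_ne_zero (m + n + 1)
    field_simp
  rw [hInt, setIntegral_congr_fun measurableSet_Ioi hf, integral_const_mul,
    integral_integral_inv_linear_pow (by fun_prop) (lt_min h₁ h₂) ?_ ?_ (m + n),
    intervalIntegral.integral_of_le zero_le_one, Nat.factorial_succ]
  · simp only [smul_eq_mul]
    have := Nat.factorial_ne_zero m
    have := Nat.factorial_ne_zero n
    push_cast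
    have : (m : ℝ) + n + 1 ≠ 0 := by positivity
    generalize (∫ x in Set.Ioc (0 : ℝ) 1, (x * l₁ + (1 - x) * l₂)⁻¹ * (x ^ m * (1 - x) ^ n)) = I
    field_simp
  · filter_upwards [ae_restrict_mem measurableSet_Ioc] with x hx
    have := mul_le_mul_of_nonneg_left (min_le_left l₁ l₂) hx.1.le
    have := mul_le_mul_of_nonneg_left (min_le_right l₁ l₂) (sub_nonneg.2 hx.2)
    linarith
  · exact (Continuous.intervalIntegrable (by fun_prop) 0 1).1

lemma integral_cos_sin_eq {l₁ l₂ : ℝ} (h₁ : 0 < l₁) (h₂ : 0 < l₂) (m n : ℕ) :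
    ∫ α in (0 : ℝ)..(Real.pi / 2), Real.cos α ^ (2 * m + 1) * Real.sin α ^ (2 * n + 1) /
        (Real.cos α ^ 2 * l₁ + Real.sin α ^ 2 * l₂)
      = 1 / 2 * ∫ x in (0 : ℝ)..1, (x * l₁ + (1 - x) * l₂)⁻¹ * (x ^ m * (1 - x) ^ n) := by
  have hder : ∀ x ∈ Set.uIcc 0 (Real.pi / 2), HasDerivAt (fun α => Real.cos α ^ 2)
      (2 * Real.cos x * -Real.sin x) x := by
    intro x _
    simpa using (Real.hasDerivAt_cos x).fun_pow 2
  have h := intervalIntegral.integral_comp_mul_deriv' hder (by fun_prop)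
    (g := fun x : ℝ => (x * l₁ + (1 - x) * l₂)⁻¹ * (x ^ m * (1 - x) ^ n)) (by
      refine ContinuousOn.mul (ContinuousOn.inv₀ (by fun_prop) ?_) (by fun_prop)
      rintro _ ⟨α, _, rfl⟩
      simp only
      rw [← Real.sin_sq]
      have hs := Real.sin_sq_add_cos_sq α
      rcases (sq_nonneg (Real.cos α)).eq_or_lt with hc | hc
      · rw [← hc, add_zero] at hs
        rw [← hc, hs]; simp [h₂.ne']
      · positivity)
  simp only [Real.cos_zero, Real.cos_pi_div_two, one_pow, ne_eq, OfNat.ofNat_ne_zero,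
    not_false_eq_true, zero_pow] at h
  -- The variable `cos² α` runs from `1` down to `0`, so reversing the endpoints absorbs the sign of
  -- the derivative.
  rw [intervalIntegral.integral_symm 0 1, ← neg_eq_iff_eq_neg, ← intervalIntegral.integral_neg] at h
  rw [← h, ← intervalIntegral.integral_const_mul]
  refine intervalIntegral.integral_congr fun α _ => ?_
  simp only [Function.comp, ← Real.sin_sq]
  rw [← pow_mul, ← pow_mul, div_eq_mul_inv]
  ring

/-- The denominator in `g` is `d r (λ₁ cos² α + λ₂ sin² α)`. The condition `j + k = 2` makes the
shifted exponents `m`, `n` add up to `d`, so that `Γ(d + 1)` is the factorial `(m + n)!` required by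
`hInt_eq_integral`. -/
lemma g_eq_hInt {d r : ℕ} (hr : 1 ≤ r) (hrd : r < d) {s : ℝ} (hs0 : 0 ≤ s) (hs1 : s < 1)
    {j k : ℕ} (hjk : j + k = 2) :
    g d r s j k = hInt (lam1 d r s) (lam2 d s) (r + j) (d - r + k) := by
  have hd0 : 0 < d := by omega
  have hr' : (0 : ℝ) < r := by exact_mod_cast hr
  have hd' : (0 : ℝ) < d := by exact_mod_cast hd0
  have hs : 0 < 1 - s := by linarith
  have h2 : 0 < lam2 d s := by unfold lam2; positivity
  have h1 : 0 < lam1 d r s := by unfold lam1; positivity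
  obtain ⟨m, hm⟩ : ∃ m, r + j = m + 1 := ⟨r + j - 1, by omega⟩
  obtain ⟨n, hn⟩ : ∃ n, d - r + k = n + 1 := ⟨d - r + k - 1, by omega⟩
  have e1 : (r : ℝ) + j = m + 1 := by exact_mod_cast hm
  have e2 : (d : ℝ) - r + k = n + 1 := by
    rw [← Nat.cast_sub hrd.le]; exact_mod_cast hn
  have e3 : m + n = d := by omega
  have hfun : ∀ α : ℝ, Real.cos α ^ (2 * r - 1 + 2 * j) * Real.sin α ^ (2 * d - 2 * r - 1 + 2 * k) /
        (d * s * Real.cos α ^ 2 + r * (1 - s))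
      = (d * r : ℝ)⁻¹ * (Real.cos α ^ (2 * m + 1) * Real.sin α ^ (2 * n + 1) /
        (Real.cos α ^ 2 * lam1 d r s + Real.sin α ^ 2 * lam2 d s)) := by
    intro α
    rw [show 2 * r - 1 + 2 * j = 2 * m + 1 by omega,
      show 2 * d - 2 * r - 1 + 2 * k = 2 * n + 1 by omega,
      show (d * s * Real.cos α ^ 2 + r * (1 - s) : ℝ)
        = d * r * (Real.cos α ^ 2 * lam1 d r s + Real.sin α ^ 2 * lam2 d s) by
          unfold lam1 lam2
          rw [Real.sin_sq]
          field_simp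
          ring]
    rw [div_eq_mul_inv, div_eq_mul_inv, mul_inv]
    ring
  unfold g
  simp_rw [hfun]
  rw [intervalIntegral.integral_const_mul, integral_cos_sin_eq h1 h2, hm, hn,
    hInt_eq_integral h1 h2, e1, e2, e3, Real.Gamma_nat_eq_factorial, Real.Gamma_nat_eq_factorial,
    Real.Gamma_nat_eq_factorial]
  generalize (∫ x in (0 : ℝ)..1, (x * lam1 d r s + (1 - x) * lam2 d s)⁻¹ *
    (x ^ m * (1 - x) ^ n)) = I
  field_simp

/-! ### Positivity, Cauchy–Schwarz, linear relations and limits for the half-line integrals. -/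

section hInt

variable {l₁ l₂ : ℝ}

lemma integrableOn_hInt (h₁ : 0 < l₁) (h₂ : 0 < l₂) {m n : ℕ} (hmn : 2 ≤ m + n) :
    IntegrableOn (fun z : ℝ => ((1 + z * l₁) ^ m * (1 + z * l₂) ^ n)⁻¹) (Set.Ioi 0) := by
  obtain ⟨k, hk⟩ := Nat.exists_eq_add_of_le hmn
  have hl := lt_min h₁ h₂
  refine (integrableOn_inv_linear_pow hl k).mono' (by fun_prop) ?_
  filter_upwards [ae_restrict_mem measurableSet_Ioi] with z hz
  have hz' : 0 < z := hz
  rw [Real.norm_eq_abs, abs_of_pos (by positivity), show k + 2 = m + n by omega, pow_add]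
  have := min_le_left l₁ l₂
  have := min_le_right l₁ l₂
  gcongr

lemma hInt_pos (h₁ : 0 < l₁) (h₂ : 0 < l₂) {m n : ℕ} (hmn : 2 ≤ m + n) : 0 < hInt l₁ l₂ m n := by
  obtain ⟨k, hk⟩ := Nat.exists_eq_add_of_le hmn
  have hl : 0 < max l₁ l₂ := lt_max_of_lt_left h₁
  have h : 0 < (((k : ℝ) + 1) * max l₁ l₂)⁻¹ := by positivity
  rw [← integral_inv_linear_pow hl k] at h
  refine h.trans_le (setIntegral_mono_on (integrableOn_inv_linear_pow hl k)
    (integrableOn_hInt h₁ h₂ hmn) measurableSet_Ioi fun z hz => ?_)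
  have hz' : 0 < z := hz
  rw [show k + 2 = m + n by omega, pow_add]
  have := le_max_left l₁ l₂
  have := le_max_right l₁ l₂
  gcongr

/-- Cauchy–Schwarz by the discriminant: with `A = 1 + z l₁`, `B = 1 + z l₂`, the quadratic in `t` is
the integral of `A^(-m) B^(-n) (t / A + 1 / B)²`. It gives `b² ≤ a c`. -/
lemma hInt_sq_le (h₁ : 0 < l₁) (h₂ : 0 < l₂) (m n : ℕ) :
    hInt l₁ l₂ (m + 1) (n + 1) ^ 2 ≤ hInt l₁ l₂ (m + 2) n * hInt l₁ l₂ m (n + 2) := by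
  have key : ∀ t : ℝ, 0 ≤ hInt l₁ l₂ (m + 2) n * (t * t) + 2 * hInt l₁ l₂ (m + 1) (n + 1) * t
      + hInt l₁ l₂ m (n + 2) := by
    intro t
    have i1 := (integrableOn_hInt h₁ h₂ (m := m + 2) (n := n) (by omega)).mul_const (t * t)
    have i2 := ((integrableOn_hInt h₁ h₂ (m := m + 1) (n := n + 1) (by omega)).const_mul 2).mul_const t
    have i3 := integrableOn_hInt h₁ h₂ (m := m) (n := n + 2) (by omega)
    simp only [hInt]
    rw [← integral_mul_const, ← integral_const_mul, ← integral_mul_const,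
      ← integral_add i1 i2, ← integral_add (f := fun z : ℝ => _ + _) (i1.add i2) i3]
    refine setIntegral_nonneg measurableSet_Ioi fun z (hz : 0 < z) => ?_
    have hA : 0 < 1 + z * l₁ := by positivity
    have hB : 0 < 1 + z * l₂ := by positivity
    have e : ((1 + z * l₁) ^ (m + 2) * (1 + z * l₂) ^ n)⁻¹ * (t * t)
        + 2 * ((1 + z * l₁) ^ (m + 1) * (1 + z * l₂) ^ (n + 1))⁻¹ * t
        + ((1 + z * l₁) ^ m * (1 + z * l₂) ^ (n + 2))⁻¹
        = ((1 + z * l₁) ^ m * (1 + z * l₂) ^ n)⁻¹ *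
          (t * (1 + z * l₁)⁻¹ + (1 + z * l₂)⁻¹) ^ 2 := by
      field_simp
      ring
    rw [e]
    positivity
  have := discrim_le_zero key
  unfold discrim at this
  nlinarith

/-- The combined integrand is the derivative of `-(1 + z l₁)^(-m-1) (1 + z l₂)^(-n)`, which rises
from `-1` to `0`. -/
lemma hInt_linear_relation (h₁ : 0 < l₁) (h₂ : 0 < l₂) (m n : ℕ) :
    (m + 1) * l₁ * hInt l₁ l₂ (m + 2) n + n * l₂ * hInt l₁ l₂ (m + 1) (n + 1) = 1 := by
  have i1 := (integrableOn_hInt h₁ h₂ (m := m + 2) (n := n) (by omega)).const_mul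
    (((m : ℝ) + 1) * l₁)
  have i2 := (integrableOn_hInt h₁ h₂ (m := m + 1) (n := n + 1) (by omega)).const_mul (n * l₂)
  simp only [hInt]
  rw [← integral_const_mul, ← integral_const_mul, ← integral_add i1 i2]
  have hder : ∀ z ∈ Set.Ici (0 : ℝ), HasDerivAt
      (fun z : ℝ => -((1 + z * l₁) ^ (m + 1) * (1 + z * l₂) ^ n)⁻¹)
      ((m + 1) * l₁ * ((1 + z * l₁) ^ (m + 2) * (1 + z * l₂) ^ n)⁻¹
        + n * l₂ * ((1 + z * l₁) ^ (m + 1) * (1 + z * l₂) ^ (n + 1))⁻¹) z := by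
    intro z (hz : 0 ≤ z)
    have hA : 0 < 1 + z * l₁ := by positivity
    have hB : 0 < 1 + z * l₂ := by positivity
    have d1 : HasDerivAt (fun z : ℝ => 1 + z * l₁) l₁ z := by
      simpa using ((hasDerivAt_id z).mul_const l₁).const_add 1
    have d2 : HasDerivAt (fun z : ℝ => 1 + z * l₂) l₂ z := by
      simpa using ((hasDerivAt_id z).mul_const l₂).const_add 1
    have := (((d1.fun_pow (m + 1)).fun_mul (d2.fun_pow n)).fun_inv (by positivity)).fun_neg
    refine this.congr_deriv ?_
    -- The derivative of the `n`-th power contains the truncated exponent `n - 1`, so `n = 0` is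
    -- separate.
    rcases n with _ | n
    · rw [Nat.add_sub_cancel]
      push_cast
      field_simp
      ring
    · rw [Nat.add_sub_cancel, Nat.add_sub_cancel]
      push_cast
      field_simp
      ring
  have hlim : Tendsto (fun z : ℝ => -((1 + z * l₁) ^ (m + 1) * (1 + z * l₂) ^ n)⁻¹) atTop (𝓝 0) := by
    have := tendsto_inv_linear_pow h₁ m
    rw [← neg_zero]
    refine Tendsto.neg (squeeze_zero' ?_ ?_ this)
    · filter_upwards [eventually_ge_atTop (0 : ℝ)] with z hz
      positivity
    · filter_upwards [eventually_ge_atTop (0 : ℝ)] with z hz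
      have : 1 ≤ (1 + z * l₂) ^ n := one_le_pow₀ (by nlinarith)
      gcongr
      exact le_mul_of_one_le_right (by positivity) this
  rw [integral_Ioi_of_hasDerivAt_of_tendsto' hder (i1.add i2) hlim]
  simp

end hInt

/-- Dominated convergence: eventually the first slope exceeds `l / 2`, and the second factor is at
least `1` because its slope is nonnegative. The exponent `k + 2` keeps the majorant integrable after
the second factor has disappeared in the limit. -/
lemma tendsto_hInt {l : ℝ} (hl : 0 < l) {f₁ f₂ : ℝ → ℝ} {F : Filter ℝ} [F.IsCountablyGenerated]
    (h₁ : Tendsto f₁ F (𝓝 l)) (h₂ : Tendsto f₂ F (𝓝 0)) (h₂' : ∀ᶠ s in F, 0 ≤ f₂ s) (k n : ℕ) :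
    Tendsto (fun s => hInt (f₁ s) (f₂ s) (k + 2) n) F (𝓝 ((((k : ℝ) + 1) * l)⁻¹)) := by
  rw [← integral_inv_linear_pow hl k]
  refine tendsto_integral_filter_of_dominated_convergence
    (fun z => ((1 + z * (l / 2)) ^ (k + 2))⁻¹) (Eventually.of_forall fun s => by fun_prop) ?_
    (integrableOn_inv_linear_pow (half_pos hl) k) 
    ((ae_restrict_mem measurableSet_Ioi).mono fun z hz => ?_)
  · filter_upwards [h₁.eventually_const_le (half_lt_self hl), h₂'] with s hs1 hs2
    filter_upwards [ae_restrict_mem measurableSet_Ioi] with z hz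
    have hz' : 0 < z := hz
    have : 0 < f₁ s := (half_pos hl).trans_le hs1
    rw [Real.norm_eq_abs, abs_of_nonneg (by positivity)]
    have h1 : 1 ≤ (1 + z * f₂ s) ^ n := one_le_pow₀ (by nlinarith)
    refine inv_anti₀ (by positivity) ?_
    calc (1 + z * (l / 2)) ^ (k + 2) ≤ (1 + z * f₁ s) ^ (k + 2) := by gcongr
      _ ≤ _ := le_mul_of_one_le_right (by positivity) h1
  · have hc : Tendsto (fun s => ((1 + z * f₁ s) ^ (k + 2) * (1 + z * f₂ s) ^ n)⁻¹) F
        (𝓝 (((1 + z * l) ^ (k + 2) * (1 + z * 0) ^ n)⁻¹)) := by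
      refine Tendsto.inv₀ ?_ ?_
      · exact (((h₁.const_mul z).const_add 1).pow _).mul (((h₂.const_mul z).const_add 1).pow _)
      · have hz' : 0 < z := hz
        positivity
    simpa using hc

/-! ### The logarithmic integral by which the `g_{jk}` are evaluated. -/

lemma integral_cos_mul_sin_pow (m : ℕ) :
    ∫ α in (0 : ℝ)..(Real.pi / 2), Real.cos α * Real.sin α ^ (2 * m + 1)
      = 1 / (2 * ((m : ℝ) + 1)) := by
  have hder : ∀ x ∈ Set.uIcc 0 (Real.pi / 2), HasDerivAt
      (fun α => Real.sin α ^ (2 * m + 2) / (2 * ((m : ℝ) + 1)))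
      (Real.cos x * Real.sin x ^ (2 * m + 1)) x := by
    intro x _
    refine (((Real.hasDerivAt_sin x).fun_pow (2 * m + 2)).div_const _).congr_deriv ?_
    rw [show 2 * m + 2 - 1 = 2 * m + 1 by omega]
    push_cast
    field_simp
  rw [intervalIntegral.integral_eq_sub_of_hasDerivAt hder
    (Continuous.intervalIntegrable (by fun_prop) _ _)]
  simp

/-- Induction on `m` through `sin² α = (1 + u) - (cos² α + u)`: the first term reproduces the
previous integral times `1 + u`, the second cancels the denominator and supplies the `n = 0` term of
the new sum. -/
theorem integral_cos_mul_sin_pow_div (m : ℕ) {u : ℝ} (hu : 0 < u) :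
    ∫ α in (0 : ℝ)..(Real.pi / 2),
        Real.cos α * Real.sin α ^ (2 * m + 1) / (Real.cos α ^ 2 + u) =
      (1 / 2) * (1 + u) ^ m * Real.log ((1 + u) / u)
        - (1 / 2) * ∑ n ∈ Finset.range m, (1 + u) ^ n / ((m : ℝ) - n) := by
  have hpos : ∀ α : ℝ, 0 < Real.cos α ^ 2 + u := fun α => by positivity
  have hcont : ∀ m : ℕ, Continuous fun α : ℝ =>
      Real.cos α * Real.sin α ^ (2 * m + 1) / (Real.cos α ^ 2 + u) := fun m =>
    Continuous.div (by fun_prop) (by fun_prop) fun α => (hpos α).ne'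
  induction m with
  | zero =>
    have hder : ∀ x ∈ Set.uIcc 0 (Real.pi / 2), HasDerivAt
        (fun α => -(1 / 2) * Real.log (Real.cos α ^ 2 + u))
        (Real.cos x * Real.sin x ^ (2 * 0 + 1) / (Real.cos x ^ 2 + u)) x := by
      intro x _
      refine (((((Real.hasDerivAt_cos x).fun_pow 2).add_const u).log
        (hpos x).ne').const_mul _).congr_deriv ?_
      have := (hpos x).ne'
      field_simp
      simp
    rw [intervalIntegral.integral_eq_sub_of_hasDerivAt hder ((hcont 0).intervalIntegrable _ _),
      Real.log_div (by positivity) hu.ne']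
    simp
    ring
  | succ m ih =>
    have e : ∀ α : ℝ, Real.cos α * Real.sin α ^ (2 * (m + 1) + 1) / (Real.cos α ^ 2 + u)
        = (1 + u) * (Real.cos α * Real.sin α ^ (2 * m + 1) / (Real.cos α ^ 2 + u))
          - Real.cos α * Real.sin α ^ (2 * m + 1) := by
      intro α
      have := (hpos α).ne'
      rw [show 2 * (m + 1) + 1 = 2 * m + 1 + 2 by ring, pow_add, Real.sin_sq]
      field_simp
      ring
    simp_rw [e]
    have i1 : IntervalIntegrable (fun α => (1 + u) *
        (Real.cos α * Real.sin α ^ (2 * m + 1) / (Real.cos α ^ 2 + u))) volume 0 (Real.pi / 2) :=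
      (continuous_const.mul (hcont m)).intervalIntegrable _ _
    have i2 : IntervalIntegrable (fun α => Real.cos α * Real.sin α ^ (2 * m + 1)) volume 0
        (Real.pi / 2) := Continuous.intervalIntegrable (by fun_prop) _ _
    rw [intervalIntegral.integral_sub i1 i2, intervalIntegral.integral_const_mul, ih,
      integral_cos_mul_sin_pow, Finset.sum_range_succ']
    have e2 : ∑ k ∈ Finset.range m, (1 + u) ^ (k + 1) / (((m + 1 : ℕ) : ℝ) - ((k + 1 : ℕ) : ℝ))
        = (1 + u) * ∑ n ∈ Finset.range m, (1 + u) ^ n / ((m : ℝ) - n) := by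
      rw [Finset.mul_sum]
      refine Finset.sum_congr rfl fun k _ => ?_
      push_cast
      rw [show (m : ℝ) + 1 - (k + 1) = m - k by ring]
      ring
    rw [e2]
    push_cast
    rw [pow_zero, sub_zero]
    field_simp
    ring

/-! ### Born probabilities of `ρ_r(s)` and the entries of its frame superoperator. -/

/-- The eigenvalues of `ρ_r(s)`. -/
def lamVec (d r : ℕ) (s : ℝ) (m : Fin d) : ℝ := if m.val < r then lam1 d r s else lam2 d s

lemma lam2_pos {d r : ℕ} (hrd : r < d) {s : ℝ} (hs1 : s < 1) :
    0 < lam2 d s := by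
  have hd' : (0 : ℝ) < d := by exact_mod_cast (Nat.zero_le r).trans_lt hrd
  exact div_pos (sub_pos.2 hs1) hd'

lemma lam1_pos {d r : ℕ} (hrd : r < d) {s : ℝ} (hs0 : 0 ≤ s) (hs1 : s < 1) :
    0 < lam1 d r s :=
  add_pos_of_nonneg_of_pos (by positivity) (lam2_pos hrd hs1)

lemma lamVec_pos {d r : ℕ} (hrd : r < d) {s : ℝ} (hs0 : 0 ≤ s) (hs1 : s < 1) (m : Fin d) :
    0 < lamVec d r s m := by
  unfold lamVec
  split_ifs
  · exact lam1_pos hrd hs0 hs1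
  · exact lam2_pos hrd hs1

lemma rhoState_eq (d r : ℕ) (s : ℝ) :
    rhoState d r s = Matrix.diagonal fun m => ((lamVec d r s m : ℝ) : ℂ) := by
  ext i j
  have h : (∑ m : Fin d with m.val < r, E m m) i j
      = if i = j ∧ i.val < r then (1 : ℂ) else 0 := by
    rw [Matrix.sum_apply, Finset.sum_filter]
    simp only [E, Matrix.single_apply]
    rw [Finset.sum_eq_single i]
    · by_cases h1 : i = j <;> by_cases h2 : i.val < r <;> simp [h1, h2]
    · intro b _ hb; simp [hb]
    · simp
  simp only [rhoState, Matrix.add_apply, Matrix.smul_apply, h, Matrix.diagonal_apply,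
    Matrix.one_apply, lamVec, lam1, lam2, smul_eq_mul]
  by_cases h1 : i = j <;> by_cases h2 : i.val < r <;> simp [h1]
  · subst h1; simp [h2]
  · subst h1; simp [h2]

lemma born_rhoState (d r : ℕ) (s : ℝ) (ψ : PureState d) :
    born (rhoState d r s) ψ = wForm (lamVec d r s) ψ.1 := by
  rw [born, rhoState_eq, Matrix.trace, Complex.re_sum, wForm]
  refine Finset.sum_congr rfl fun m _ => ?_
  rw [Matrix.diag_apply, Matrix.mul_diagonal, ketbra, Matrix.of_apply, Complex.star_def,
    Complex.mul_conj, ← Complex.ofReal_mul, Complex.ofReal_re, Complex.normSq_eq_norm_sq, mul_comm]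

lemma dOuter_apply {d : ℕ} (A B X : Op d) : dOuter A B X = (Bᴴ * X).trace • A := rfl

lemma trace_conjTranspose_mul_E {d : ℕ} (B : Op d) (k l : Fin d) :
    (Bᴴ * E k l).trace = star (B k l) := by
  simp [E, Matrix.trace_mul_single]

lemma trace_E_conjTranspose_mul {d : ℕ} (X : Op d) (k l : Fin d) :
    ((E k l)ᴴ * X).trace = X k l := by
  simp [E, Matrix.trace_single_mul]

lemma superOp_ext {d : ℕ} {S T : SuperOp d} (h : ∀ k l i j, S (E k l) i j = T (E k l) i j) :
    S = T := by
  refine Matrix.ext_linearMap ℂ fun k l => ?_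
  refine LinearMap.ext_ring ?_
  ext i j
  exact h k l i j

lemma haarIntegral_apply_E {d : ℕ} (T : PureState d → SuperOp d) (k l i j : Fin d) :
    haarIntegral T (E k l) i j = ∫ ψ, T ψ (E k l) i j ∂haarPure d := by
  simp only [haarIntegral, LinearMap.sum_apply, LinearMap.smul_apply, dOuter_apply,
    trace_E_conjTranspose_mul, Matrix.sum_apply, Matrix.smul_apply, smul_eq_mul]
  rw [Finset.sum_eq_single i, Finset.sum_eq_single j, Finset.sum_eq_single k,
    Finset.sum_eq_single l]
  · simp [E]
  all_goals first
    | (intro b _ hb; simp [E, Matrix.single_apply, hb, hb.symm])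
    | simp

/-- The exponents of the monomial `ψ_l ψ_i`. -/
def pairExp {d : ℕ} (l i m : Fin d) : ℕ := (if m = l then 1 else 0) + (if m = i then 1 else 0)

/-- The right-hand side is the `(i, j)` entry of `|Π_ψ⟩⟩⟨⟨Π_ψ|` applied to `E_{kl}`. -/
lemma monom_pairExp {d : ℕ} (l i k j : Fin d) (x : EuclideanSpace ℂ (Fin d)) :
    monom (pairExp l i) (pairExp k j) x = star (star (x l) * x k) * (x i * star (x j)) := by
  simp only [monom, pairExp, pow_add, Finset.prod_mul_distrib, pow_ite, pow_one, pow_zero,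
    Finset.prod_ite_eq', Finset.mem_univ, if_true, star_mul', star_star]
  ring

/-- Exponent vectors record multisets, so the two pairings of `{l, i}` with `{k, j}` decide which
entries survive. -/
lemma pairExp_eq_iff {d : ℕ} (l i k j : Fin d) :
    pairExp l i = pairExp k j ↔ (l = k ∧ i = j) ∨ (l = j ∧ i = k) := by
  constructor
  · intro h
    have h1 := congrFun h l
    have h2 := congrFun h i
    have h3 := congrFun h k
    have h4 := congrFun h j
    simp only [pairExp] at h1 h2 h3 h4
    grind
  · rintro (⟨rfl, rfl⟩ | ⟨rfl, rfl⟩)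
    · rfl
    · funext m; simp only [pairExp, add_comm]

lemma sum_pairExp {d : ℕ} (l i k j : Fin d) : ∑ m, (pairExp l i m + pairExp k j m) = 2 * 2 := by
  simp [pairExp, Finset.sum_add_distrib]

/-- The representation of `1 / p` by inverse powers is used with exponent `d + 2`, matching a
monomial of degree `2 · 2` in `integral_haarPure_monom`. On the sphere the constant `1` is absorbed
into the weights `1 + z λ_m`, and the prefactor `(d - 1)! / (d + 1)! = 1 / (d (d + 1))` cancels the
factors `d` and `d + 1`. -/
lemma integral_monom_inv_wForm {d : ℕ} (hd : 0 < d) {lam : Fin d → ℝ} (hlam : ∀ m, 0 < lam m)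
    {p q : Fin d → ℕ} (hpq : ∑ m, (p m + q m) = 2 * 2) :
    (d : ℂ) * ∫ ψ : PureState d, (((wForm lam ψ.1)⁻¹ : ℝ) : ℂ) * monom p q ψ.1 ∂haarPure d
      = ∫ z in Set.Ioi (0 : ℝ), ∏ m, if p m = q m then
          (((p m).factorial / (1 + z * lam m) ^ (p m + 1) : ℝ) : ℂ) else 0 := by
  have : Nonempty (Fin d) := ⟨⟨0, hd⟩⟩
  have := isProbabilityMeasure_haarPure hd
  obtain ⟨m₀, hm₀⟩ := Finite.exists_min lam
  have hc : Continuous fun ψ : PureState d => monom p q ψ.1 :=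
    (continuous_monom p q).comp continuous_subtype_val
  have hint : Integrable (fun ψ : PureState d => monom p q ψ.1) (haarPure d) := by
    rw [← integrableOn_univ]
    exact hc.continuousOn.integrableOn_compact isCompact_univ
  have h := integral_integral_inv_linear_pow (μ := haarPure d)
    (p := fun ψ : PureState d => wForm lam ψ.1)
    ((continuous_wForm lam).comp continuous_subtype_val).measurable (hlam m₀)
    (Eventually.of_forall fun ψ => le_wForm_sphere hm₀ ψ) hint d
  simp only [Complex.real_smul] at h
  have hd' : (d : ℂ) ≠ 0 := by exact_mod_cast hd.ne'
  have hd1 : (d : ℂ) + 1 ≠ 0 := by exact_mod_cast Nat.succ_ne_zero d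
  have e : ∀ z ∈ Set.Ioi (0 : ℝ), ∫ ψ : PureState d,
      ((((1 + z * wForm lam ψ.1) ^ (d + 2))⁻¹ : ℝ) : ℂ) * monom p q ψ.1 ∂haarPure d
      = ((d : ℂ) * (d + 1))⁻¹ * ∏ m, if p m = q m then
          (((p m).factorial / (1 + z * lam m) ^ (p m + 1) : ℝ) : ℂ) else 0 := by
    intro z (hz : 0 < z)
    have h2 := integral_haarPure_monom hd p q 2 (fun m => 1 + z * lam m)
      (fun m => by have := hlam m; positivity) hpq
    have e1 : ∀ ψ : PureState d, wForm (fun m => 1 + z * lam m) ψ.1 = 1 + z * wForm lam ψ.1 := by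
      intro ψ
      simp only [wForm, add_mul, one_mul, Finset.sum_add_distrib, sum_norm_sq_sphere, mul_assoc,
        Finset.mul_sum]
    obtain ⟨n, rfl⟩ : ∃ n, d = n + 1 := ⟨d - 1, by omega⟩
    rw [show n + 1 + 2 - 1 = n + 2 by omega, Nat.add_sub_cancel, Nat.factorial_succ,
      Nat.factorial_succ] at h2
    simp_rw [e1, mul_comm (monom p q _)] at h2
    have hn : (n.factorial : ℂ) ≠ 0 := by exact_mod_cast Nat.factorial_ne_zero n
    push_cast at h2 hd' hd1 ⊢
    rw [eq_inv_mul_iff_mul_eq₀ (mul_ne_zero hd' hd1)]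
    apply mul_left_cancel₀ hn
    rw [← h2]
    ring
  rw [setIntegral_congr_fun measurableSet_Ioi e, integral_const_mul] at h
  rw [← mul_right_inj' (inv_ne_zero (mul_ne_zero hd' hd1)), h]
  push_cast
  field_simp

lemma integral_monom_inv_wForm_of_ne {d : ℕ} (hd : 0 < d) {lam : Fin d → ℝ}
    (hlam : ∀ m, 0 < lam m) {p q : Fin d → ℕ} (hpq : ∑ m, (p m + q m) = 2 * 2) (hne : p ≠ q) :
    (d : ℂ) * ∫ ψ : PureState d, (((wForm lam ψ.1)⁻¹ : ℝ) : ℂ) * monom p q ψ.1 ∂haarPure d = 0 := by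
  rw [integral_monom_inv_wForm hd hlam hpq]
  obtain ⟨m, hm⟩ := Function.ne_iff.1 hne
  rw [integral_congr_ae (Eventually.of_forall fun z =>
    Finset.prod_eq_zero (Finset.mem_univ m) (by simp only [if_neg hm])), integral_zero]

lemma card_filter_lt {d r : ℕ} (hrd : r ≤ d) :
    (Finset.univ.filter fun m : Fin d => m.val < r).card = r := by
  rw [Fin.card_filter_val_lt, min_eq_right hrd]

lemma card_filter_not_lt {d r : ℕ} (hrd : r ≤ d) :
    (Finset.univ.filter fun m : Fin d => ¬ m.val < r).card = d - r := by
  have := Finset.card_filter_add_card_filter_not (s := (Finset.univ : Finset (Fin d)))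
    (fun m : Fin d => m.val < r)
  rw [card_filter_lt hrd, Finset.card_univ, Fintype.card_fin] at this
  omega

lemma prod_one_add_mul_lamVec {d r : ℕ} (hrd : r ≤ d) (s z : ℝ) :
    ∏ m, (1 + z * lamVec d r s m)
      = (1 + z * lam1 d r s) ^ r * (1 + z * lam2 d s) ^ (d - r) := by
  have : ∀ m : Fin d, 1 + z * lamVec d r s m
      = if m.val < r then 1 + z * lam1 d r s else 1 + z * lam2 d s := by
    intro m; unfold lamVec; split_ifs <;> rfl
  simp_rw [this]
  rw [Finset.prod_ite, Finset.prod_const, Finset.prod_const, card_filter_lt hrd,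
    card_filter_not_lt hrd]

lemma prod_factorial_pairExp {d : ℕ} (l i : Fin d) :
    ∏ m, ((pairExp l i m).factorial : ℝ) = 1 + if l = i then 1 else 0 := by
  rw [Finset.prod_eq_single l]
  · unfold pairExp
    by_cases h : l = i <;> simp [h]; norm_num
  · intro m _ hm
    unfold pairExp
    rw [if_neg hm]
    split_ifs <;> simp
  · simp

lemma prod_pow_pairExp {d : ℕ} (l i : Fin d) (x : Fin d → ℝ) :
    ∏ m, x m ^ (pairExp l i m + 1) = x l * x i * ∏ m, x m := by
  simp only [pairExp, pow_add, Finset.prod_mul_distrib, pow_ite, pow_one, pow_zero,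
    Finset.prod_ite_eq', Finset.mem_univ, if_true]

/-- Each of the indices `l`, `i` raises the exponent of its block by one, so their blocks select
`a`, `b` or `c`; the factor `1 + δ` is the factorial `2!` of a repeated index. -/
lemma integral_frame_entry {d r : ℕ} (hr : 1 ≤ r) (hrd : r < d) {s : ℝ} (hs0 : 0 ≤ s) (hs1 : s < 1)
    (l i : Fin d) :
    (d : ℂ) * ∫ ψ : PureState d, (((wForm (lamVec d r s) ψ.1)⁻¹ : ℝ) : ℂ) *
        monom (pairExp l i) (pairExp l i) ψ.1 ∂haarPure d
      = (((1 + if l = i then 1 else 0) * blockVal d r s l i : ℝ) : ℂ) := by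
  rw [integral_monom_inv_wForm (by omega) (lamVec_pos hrd hs0 hs1) (sum_pairExp l i l i)]
  have e : ∀ z : ℝ, (∏ m, if pairExp l i m = pairExp l i m then
        (((pairExp l i m).factorial / (1 + z * lamVec d r s m) ^ (pairExp l i m + 1) : ℝ) : ℂ) else 0)
      = (((1 + if l = i then 1 else 0) * ((1 + z * lamVec d r s l) * (1 + z * lamVec d r s i) *
        ((1 + z * lam1 d r s) ^ r * (1 + z * lam2 d s) ^ (d - r)))⁻¹ : ℝ) : ℂ) := by
    intro z
    simp only [if_true]
    rw [← Complex.ofReal_prod, Finset.prod_div_distrib, prod_factorial_pairExp, prod_pow_pairExp,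
      prod_one_add_mul_lamVec hrd.le, div_eq_mul_inv]
  rw [integral_congr_ae (Eventually.of_forall e), integral_complex_ofReal, integral_const_mul]
  congr 2
  unfold blockVal aPar bPar cPar
  rw [g_eq_hInt hr hrd hs0 hs1 rfl, g_eq_hInt hr hrd hs0 hs1 rfl, g_eq_hInt hr hrd hs0 hs1 rfl]
  simp only [lamVec, hInt]
  by_cases h1 : l.val < r <;> by_cases h2 : i.val < r <;>
    simp only [h1, h2, if_true, if_false, and_self, and_true, and_false, not_lt.1,
      not_le.2, not_false_eq_true]
  all_goals
    congr 1; funext z; congr 1; ring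

/-! ### The algebra of block-constant matrices. -/

section BlockMatrices

variable {d : ℕ}

/-- The value `x`, `y` or `z` attached to a pair of indices by the blocks they lie in. -/
def blk {R : Type*} (d r : ℕ) (x y z : R) (i j : Fin d) : R :=
  if i.val < r ∧ j.val < r then x else if r ≤ i.val ∧ r ≤ j.val then z else y

/-- The matrix which is constant on the four blocks, up to constants on the two diagonals. -/
def bm (d r : ℕ) (x y p q t w : ℝ) : Matrix (Fin d) (Fin d) ℝ :=
  Matrix.of fun i j => (if i = j then (if i.val < r then x else y) else 0) +
    if i.val < r then (if j.val < r then p else q) else (if j.val < r then t else w)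

lemma sum_block {r : ℕ} (hrd : r ≤ d) (x y : ℝ) :
    ∑ m : Fin d, (if m.val < r then x else y) = r * x + ((d : ℝ) - r) * y := by
  rw [Finset.sum_ite, Finset.sum_const, Finset.sum_const, card_filter_lt hrd,
    card_filter_not_lt hrd, nsmul_eq_mul, nsmul_eq_mul, Nat.cast_sub hrd]

/-- These matrices are closed under multiplication, so identities between `d × d` matrices reduce to
six scalar ones. -/
lemma bm_mul {r : ℕ} (hrd : r ≤ d) (x y p q t w x' y' p' q' t' w' : ℝ) :
    bm d r x y p q t w * bm d r x' y' p' q' t' w' =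
      bm d r (x * x') (y * y')
        (x * p' + p * x' + r * (p * p') + (d - r) * (q * t'))
        (x * q' + q * y' + r * (p * q') + (d - r) * (q * w'))
        (y * t' + t * x' + r * (t * p') + (d - r) * (w * t'))
        (y * w' + w * y' + r * (t * q') + (d - r) * (w * w')) := by
  ext i j
  rw [Matrix.mul_apply]
  simp only [bm, Matrix.of_apply, add_mul, mul_add, Finset.sum_add_distrib]
  have e : (∑ k : Fin d, (if i.val < r then (if k.val < r then p else q)
        else (if k.val < r then t else w)) *
      (if k.val < r then (if j.val < r then p' else q') else (if j.val < r then t' else w')))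
      = ∑ k : Fin d, if k.val < r then
          (if i.val < r then p else t) * (if j.val < r then p' else q')
        else (if i.val < r then q else w) * (if j.val < r then t' else w') := by
    refine Finset.sum_congr rfl fun k _ => ?_
    by_cases hk : k.val < r <;> simp [hk]
  have e1 : ∀ (D : ℝ) (f : Fin d → ℝ), ∑ k, (if i = k then D else 0) * f k = D * f i := by
    intro D f; simp
  have e2 : ∀ (D f : Fin d → ℝ), ∑ k, f k * (if k = j then D k else 0) = f j * D j := by
    intro D f; simp
  rw [e, sum_block hrd, e1, e1, e2]
  by_cases hij : i = j
  · subst hij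
    by_cases hi : i.val < r <;> simp [hi] <;> ring
  · by_cases hi : i.val < r <;> by_cases hj : j.val < r <;> simp [hi, hj, hij] <;> ring

lemma bm_one (d r : ℕ) : bm d r 1 1 0 0 0 0 = 1 := by
  ext i j
  simp [bm, Matrix.one_apply]

/-- The matrix is a diagonal one times `1 + U V`, with `U`, `V` factoring through dimension two;
`det (1 + U V) = det (1 + V U)` leaves a `2 × 2` determinant. -/
lemma det_bm {r : ℕ} (hr : 1 ≤ r) (hrd : r < d) {x y : ℝ} (hx : x ≠ 0) (hy : y ≠ 0)
    (p q t w : ℝ) :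
    (bm d r x y p q t w).det = x ^ (r - 1) * y ^ (d - r - 1) *
      ((x + r * p) * (y + ((d : ℝ) - r) * w) - r * (d - r) * (q * t)) := by
  let D : Fin d → ℝ := fun i => if i.val < r then x else y
  let U : Matrix (Fin d) (Fin 2) ℝ := Matrix.of fun i a =>
    (D i)⁻¹ * if a = 0 then (if i.val < r then 1 else 0) else (if i.val < r then 0 else 1)
  let V : Matrix (Fin 2) (Fin d) ℝ := Matrix.of fun a j =>
    if a = 0 then (if j.val < r then p else q) else (if j.val < r then t else w)
  have hD : ∀ i, D i ≠ 0 := fun i => by simp only [D]; split_ifs <;> assumption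
  have h1 : bm d r x y p q t w = Matrix.diagonal D * (1 + U * V) := by
    ext i j
    rw [Matrix.diagonal_mul, Matrix.add_apply, Matrix.mul_apply, Fin.sum_univ_two,
      Matrix.one_apply]
    have := hD i
    simp only [bm, U, V, Matrix.of_apply, if_true, one_ne_zero, if_false]
    by_cases hi : i.val < r <;> simp only [hi, if_true, if_false] <;> field_simp <;>
      simp [D, hi]
  have h2 : V * U = !![r * (p / x), (d - r) * (q / y); r * (t / x), (d - r) * (w / y)] := by
    ext a b
    rw [Matrix.mul_apply]
    have e : ∀ m : Fin d, V a m * U m b =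
        if m.val < r then (if a = 0 then p else t) * (if b = 0 then x⁻¹ else 0)
          else (if a = 0 then q else w) * (if b = 0 then 0 else y⁻¹) := by
      intro m
      simp only [U, V, D, Matrix.of_apply]
      by_cases hm : m.val < r <;> simp [hm]
    simp_rw [e]
    rw [sum_block hrd.le]
    fin_cases a <;> fin_cases b <;> simp [div_eq_mul_inv]
  have h3 : ∏ i, D i = x ^ r * y ^ (d - r) := by
    rw [Finset.prod_ite, Finset.prod_const, Finset.prod_const, card_filter_lt hrd.le,
      card_filter_not_lt hrd.le]
  rw [h1, Matrix.det_mul, Matrix.det_diagonal, h3, Matrix.det_one_add_mul_comm, h2,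
    Matrix.one_fin_two, Matrix.det_fin_two]
  obtain ⟨r', rfl⟩ : ∃ r', r = r' + 1 := ⟨r - 1, by omega⟩
  obtain ⟨n, hn⟩ : ∃ n, d - (r' + 1) = n + 1 := ⟨d - (r' + 1) - 1, by omega⟩
  rw [hn]
  simp only [Nat.add_sub_cancel]
  simp
  field_simp
  ring

/-- The symmetric matrix with eigenvalues `x` and `y` on the vectors supported in one block with
vanishing sum, `z` on the remaining vectors of vanishing sum, and `0` on the all-ones vector. -/
def specMat (d r : ℕ) (x y z : ℝ) : Matrix (Fin d) (Fin d) ℝ :=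
  bm d r x y (-(x / r) + z * (d - r) / (d * r)) (-(z / d)) (-(z / d))
    (-(y / (d - r)) + z * r / (d * (d - r)))

/-- For every `t` outside `{x, y}` the value at `t` is an instance of `det_bm`, and polynomials
agreeing at infinitely many points coincide. -/
lemma charpoly_specMat {r : ℕ} (hr : 1 ≤ r) (hrd : r < d) (x y z : ℝ) :
    (specMat d r x y z).charpoly = Polynomial.X * (Polynomial.X - Polynomial.C x) ^ (r - 1)
      * (Polynomial.X - Polynomial.C y) ^ (d - r - 1) * (Polynomial.X - Polynomial.C z) := by
  have hr' : (r : ℝ) ≠ 0 := by exact_mod_cast (by omega : r ≠ 0)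
  have hd' : (d : ℝ) ≠ 0 := by exact_mod_cast (by omega : d ≠ 0)
  have hn' : (d : ℝ) - r ≠ 0 := sub_ne_zero.2 (by exact_mod_cast hrd.ne')
  refine Polynomial.eq_of_infinite_eval_eq _ _ ?_
  refine Set.Infinite.mono (s := {x, y}ᶜ) ?_ (Set.Finite.infinite_compl (Set.toFinite _))
  intro t ht
  simp only [Set.mem_compl_iff, Set.mem_insert_iff, Set.mem_singleton_iff, not_or] at ht
  have e : Matrix.scalar (Fin d) t - specMat d r x y z
      = bm d r (t - x) (t - y) (-(-(x / r) + z * (d - r) / (d * r))) (z / d) (z / d)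
        (-(-(y / (d - r)) + z * r / (d * (d - r)))) := by
    ext i j
    simp only [specMat, bm, Matrix.sub_apply, Matrix.scalar_apply, Matrix.diagonal_apply,
      Matrix.of_apply]
    by_cases hij : i = j
    · subst hij
      by_cases hi : i.val < r <;> simp [hi] <;> ring
    · by_cases hi : i.val < r <;> by_cases hj : j.val < r <;> simp [hi, hj, hij]
  rw [Set.mem_ofPred_eq, Matrix.eval_charpoly, e, det_bm hr hrd (sub_ne_zero.2 ht.1)
    (sub_ne_zero.2 ht.2)]
  simp only [Polynomial.eval_mul, Polynomial.eval_pow, Polynomial.eval_sub, Polynomial.eval_X,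
    Polynomial.eval_C]
  field_simp
  ring

/-- Unit weights serve the MSE; the weights `1 / (2 λ_i)` serve the Bures distance. -/
lemma trace_specMat_weighted {r : ℕ} (hr : 1 ≤ r) (hrd : r < d) (x y z l₁ l₂ : ℝ) :
    ∑ i : Fin d, (if i.val < r then l₁ else l₂) * specMat d r x y z i i =
      ((r - 1) * x + (d - r) * z / d) * l₁ + ((d - r - 1) * y + r * z / d) * l₂ := by
  have hr' : (r : ℝ) ≠ 0 := by exact_mod_cast (by omega : r ≠ 0)
  have hd' : (d : ℝ) ≠ 0 := by exact_mod_cast (by omega : d ≠ 0)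
  have hn' : (d : ℝ) - r ≠ 0 := sub_ne_zero.2 (by exact_mod_cast hrd.ne')
  have e : ∀ i : Fin d, (if i.val < r then l₁ else l₂) * specMat d r x y z i i =
      if i.val < r then l₁ * (x + (-(x / r) + z * (d - r) / (d * r)))
        else l₂ * (y + (-(y / (d - r)) + z * r / (d * (d - r)))) := by
    intro i
    simp only [specMat, bm, Matrix.of_apply, if_true]
    split_ifs <;> rfl
  simp_rw [e]
  rw [sum_block hrd.le]
  field_simp
  ring

lemma sum_sum_blk {r : ℕ} (hrd : r ≤ d) (x y z : ℝ) :
    ∑ i, ∑ j, blk d r x y z i j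
      = r ^ 2 * x + 2 * r * (d - r) * y + (d - r) ^ 2 * z := by
  have e : ∀ i j : Fin d, blk d r x y z i j = if j.val < r then (if i.val < r then x else y)
      else (if i.val < r then y else z) := by
    intro i j
    unfold blk
    by_cases hi : i.val < r <;> by_cases hj : j.val < r <;>
      simp [hi, hj, not_lt.1, not_le.2]
  simp_rw [e]
  have e2 : ∀ i : Fin d, ∑ j : Fin d, (if j.val < r then (if i.val < r then x else y)
      else (if i.val < r then y else z)) = if i.val < r then r * x + (d - r) * y
        else r * y + (d - r) * z := by
    intro i
    rw [sum_block hrd]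
    split_ifs <;> rfl
  simp_rw [e2]
  rw [sum_block hrd]
  ring

lemma sum_offDiag_blk {r : ℕ} (hrd : r ≤ d) (x y z : ℝ) (N : Matrix (Fin d) (Fin d) ℝ) :
    ∑ i, ∑ j, (if i = j then N i i else blk d r x y z i j)
      = ∑ i, N i i + (r * (r - 1) * x + 2 * r * (d - r) * y + (d - r) * (d - r - 1) * z) := by
  have e : ∀ i j : Fin d, (if i = j then N i i else blk d r x y z i j)
      = blk d r x y z i j + if i = j then N i i - (if i.val < r then x else z) else 0 := by
    intro i j
    by_cases hij : i = j
    · subst hij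
      unfold blk
      by_cases hi : i.val < r
      · simp [hi]
      · simp [hi, not_lt.1 hi]
    · simp [hij]
  simp_rw [e, Finset.sum_add_distrib, Finset.sum_ite_eq, Finset.mem_univ, if_true,
    Finset.sum_sub_distrib]
  rw [sum_sum_blk hrd, sum_block hrd]
  ring

lemma prod_offDiag_blk {R : Type*} [CommMonoid R] {r : ℕ} (hrd : r ≤ d) (x y z : R) :
    ∏ i : Fin d, ∏ j : Fin d, (if i = j then 1 else blk d r x y z i j)
      = x ^ (r * (r - 1)) * y ^ (2 * r * (d - r)) * z ^ ((d - r) * (d - r - 1)) := by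
  have e : ∀ i : Fin d, ∏ j : Fin d, (if i = j then 1 else blk d r x y z i j)
      = if i.val < r then x ^ (r - 1) * y ^ (d - r) else y ^ r * z ^ (d - r - 1) := by
    intro i
    have h1 : ∏ j : Fin d, (if i = j then 1 else blk d r x y z i j)
        = ∏ j ∈ Finset.univ.erase i, if j.val < r then (if i.val < r then x else y)
          else (if i.val < r then y else z) := by
      rw [← Finset.mul_prod_erase _ _ (Finset.mem_univ i), if_pos rfl, one_mul]
      refine Finset.prod_congr rfl fun j hj => ?_
      rw [if_neg (Finset.ne_of_mem_erase hj).symm]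
      unfold blk
      by_cases hi : i.val < r <;> by_cases hj : j.val < r <;>
        simp [hi, hj, not_lt.1, not_le.2]
    rw [h1, Finset.prod_ite, Finset.prod_const, Finset.prod_const, Finset.filter_erase,
      Finset.filter_erase]
    by_cases hi : i.val < r
    · rw [Finset.card_erase_of_mem (by simp [hi]), Finset.erase_eq_of_notMem (by simp [hi]),
        card_filter_lt hrd, card_filter_not_lt hrd]
      simp [hi]
    · rw [Finset.erase_eq_of_notMem (by simp [hi]),
        Finset.card_erase_of_mem (by simpa using hi), card_filter_lt hrd, card_filter_not_lt hrd]
      simp [hi]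
  simp_rw [e]
  rw [Finset.prod_ite, Finset.prod_const, Finset.prod_const, card_filter_lt hrd,
    card_filter_not_lt hrd, mul_pow, mul_pow, ← pow_mul, ← pow_mul, ← pow_mul, ← pow_mul,
    show 2 * r * (d - r) = (d - r) * r + r * (d - r) by ring, pow_add, mul_comm (r - 1) r,
    mul_comm (d - r - 1)]
  simp only [mul_assoc]

end BlockMatrices

/-! ### Superoperators split into a diagonal block and off-diagonal multipliers. -/

section BlockSuper

variable {d : ℕ}

/-- The superoperator acting on the diagonal by the matrix `N` and on the off-diagonal entries by
multiplication by the entries of `v`. -/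
def blockSuper (v : Fin d → Fin d → ℝ) (N : Matrix (Fin d) (Fin d) ℝ) : SuperOp d where
  toFun X := Matrix.of fun i j =>
    if i = j then ∑ k, ((N i k : ℝ) : ℂ) * X k k else ((v i j : ℝ) : ℂ) * X i j
  map_add' X Y := by
    ext i j
    simp only [Matrix.of_apply, Matrix.add_apply, mul_add, Finset.sum_add_distrib]
    split_ifs <;> rfl
  map_smul' c X := by
    ext i j
    simp only [Matrix.of_apply, Matrix.smul_apply, smul_eq_mul, RingHom.id_apply, mul_left_comm _ c,
      ← Finset.mul_sum]
    split_ifs <;> rfl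

lemma blockSuper_apply (v : Fin d → Fin d → ℝ) (N : Matrix (Fin d) (Fin d) ℝ) (X : Op d)
    (i j : Fin d) : blockSuper v N X i j =
      if i = j then ∑ k, ((N i k : ℝ) : ℂ) * X k k else ((v i j : ℝ) : ℂ) * X i j := rfl

lemma blockSuper_mul (v v' : Fin d → Fin d → ℝ) (N N' : Matrix (Fin d) (Fin d) ℝ) :
    blockSuper v N * blockSuper v' N' = blockSuper (fun i j => v i j * v' i j) (N * N') := by
  refine LinearMap.ext fun X => ?_
  ext i j
  rw [Module.End.mul_apply]
  simp only [blockSuper_apply, if_true]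
  by_cases h : i = j
  · simp only [h, if_true, Matrix.mul_apply, Finset.mul_sum]
    rw [Finset.sum_comm]
    refine Finset.sum_congr rfl fun k _ => ?_
    push_cast
    rw [Finset.sum_mul]
    exact Finset.sum_congr rfl fun l _ => by ring
  · simp only [h, if_false]
    push_cast
    ring

lemma blockSuper_one : blockSuper (fun _ _ => 1) (1 : Matrix (Fin d) (Fin d) ℝ) = 1 := by
  refine LinearMap.ext fun X => ?_
  ext i j
  rw [blockSuper_apply, Module.End.one_apply]
  by_cases h : i = j
  · subst h
    simp only [if_true, Matrix.one_apply, apply_ite Complex.ofReal, Complex.ofReal_one,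
      Complex.ofReal_zero, ite_mul, one_mul, zero_mul, Finset.sum_ite_eq, Finset.mem_univ]
  · simp [h]

lemma blockSuper_congr {v v' : Fin d → Fin d → ℝ} {N N' : Matrix (Fin d) (Fin d) ℝ}
    (hv : ∀ i j, i ≠ j → v i j = v' i j) (hN : N = N') : blockSuper v N = blockSuper v' N' := by
  subst hN
  refine LinearMap.ext fun X => ?_
  ext i j
  simp only [blockSuper_apply]
  by_cases h : i = j
  · simp [h]
  · simp [h, hv i j h]

lemma blockSuper_sub (v v' : Fin d → Fin d → ℝ) (N N' : Matrix (Fin d) (Fin d) ℝ) :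
    blockSuper v N - blockSuper v' N' = blockSuper (fun i j => v i j - v' i j) (N - N') := by
  refine LinearMap.ext fun X => ?_
  ext i j
  rw [LinearMap.sub_apply, Matrix.sub_apply]
  simp only [blockSuper_apply]
  by_cases h : i = j
  · simp [h, sub_mul, Finset.sum_sub_distrib]
  · simp [h, sub_mul]

lemma blockSuper_E (v : Fin d → Fin d → ℝ) (N : Matrix (Fin d) (Fin d) ℝ) {j k : Fin d}
    (h : j ≠ k) : blockSuper v N (E j k) = ((v j k : ℝ) : ℂ) • E j k := by
  ext a b
  rw [blockSuper_apply, Matrix.smul_apply, E]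
  simp only [Matrix.single_apply, smul_eq_mul]
  by_cases hab : a = b
  · subst hab
    rw [if_pos rfl, Finset.sum_eq_zero, if_neg, mul_zero]
    · rintro ⟨rfl, rfl⟩; exact h rfl
    · intro m _
      rw [if_neg, mul_zero]
      rintro ⟨rfl, rfl⟩; exact h rfl
  · rw [if_neg hab]
    by_cases h2 : j = a ∧ k = b
    · obtain ⟨rfl, rfl⟩ := h2; rfl
    · simp [h2]

lemma blockSuper_symm (v : Fin d → Fin d → ℝ) (N : Matrix (Fin d) (Fin d) ℝ)
    (hN : N.IsSymm) (X Y : Op d) :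
    (Xᴴ * blockSuper v N Y).trace = ((blockSuper v N X)ᴴ * Y).trace := by
  simp only [Matrix.trace, Matrix.diag_apply, Matrix.mul_apply, Matrix.conjTranspose_apply]
  have e1 : ∀ i j : Fin d, star (X j i) * blockSuper v N Y j i
      = (if j = i then ∑ k, star (X j j) * (((N j k : ℝ) : ℂ) * Y k k) else 0)
        + if j = i then 0 else star (X j i) * (((v j i : ℝ) : ℂ) * Y j i) := by
    intro i j
    rw [blockSuper_apply]
    by_cases h : j = i
    · subst h; simp [Finset.mul_sum]
    · simp [h]
  have e2 : ∀ i j : Fin d, star (blockSuper v N X j i) * Y j i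
      = (if j = i then ∑ k, star (((N j k : ℝ) : ℂ) * X k k) * Y j j else 0)
        + if j = i then 0 else star (X j i) * (((v j i : ℝ) : ℂ) * Y j i) := by
    intro i j
    rw [blockSuper_apply]
    by_cases h : j = i
    · subst h; simp [Finset.sum_mul]
    · simp [h]; ring
  simp_rw [e1, e2, Finset.sum_add_distrib]
  congr 1
  simp only [Finset.sum_ite_eq', Finset.mem_univ, if_true]
  rw [Finset.sum_comm]
  refine Finset.sum_congr rfl fun i _ => Finset.sum_congr rfl fun k _ => ?_
  rw [← hN.apply k i]
  simp only [star_mul', Complex.star_def, Complex.conj_ofReal]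
  ring

lemma trace_superOp (T : SuperOp d) :
    LinearMap.trace ℂ (Op d) T = ∑ i, ∑ j, T (E i j) i j := by
  rw [LinearMap.trace_eq_matrix_trace ℂ (Matrix.stdBasis ℂ (Fin d) (Fin d)), Matrix.trace,
    Fintype.sum_prod_type]
  refine Finset.sum_congr rfl fun i _ => Finset.sum_congr rfl fun j _ => ?_
  rw [Matrix.diag_apply, LinearMap.toMatrix_apply, Matrix.stdBasis_eq_single]
  rfl

lemma trace_blockSuper (v : Fin d → Fin d → ℝ) (N : Matrix (Fin d) (Fin d) ℝ) :
    LinearMap.trace ℂ (Op d) (blockSuper v N)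
      = ((∑ i, ∑ j, (if i = j then N i i else v i j) : ℝ) : ℂ) := by
  rw [trace_superOp]
  push_cast
  refine Finset.sum_congr rfl fun i _ => Finset.sum_congr rfl fun j _ => ?_
  rw [blockSuper_apply, E]
  by_cases h : i = j
  · subst h
    simp [Matrix.single_apply]
  · simp [h]

/-- In the basis `E_{ij}` the diagonal and off-diagonal basis operators do not mix. The first block
is `N`, the second is diagonal with entries `v i j`. -/
lemma charpoly_blockSuper (v : Fin d → Fin d → ℝ) (N : Matrix (Fin d) (Fin d) ℝ) :
    (blockSuper v N).charpoly = ((∏ i, ∏ j, if i = j then 1 else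
      (Polynomial.X - Polynomial.C (v i j))) * N.charpoly).map (algebraMap ℝ ℂ) := by
  let b := Matrix.stdBasis ℂ (Fin d) (Fin d)
  let A := LinearMap.toMatrix b b (blockSuper v N)
  have hA : ∀ x y : Fin d × Fin d, A x y = blockSuper v N (E y.1 y.2) x.1 x.2 := by
    intro x y
    change LinearMap.toMatrix b b (blockSuper v N) x y = _
    rw [LinearMap.toMatrix_apply, Matrix.stdBasis_eq_single]
    rfl
  rw [← LinearMap.charpoly_toMatrix (blockSuper v N) b]
  change A.charpoly = _
  have hA0 : ∀ x y : Fin d × Fin d, x.1 ≠ x.2 → A x y = if x = y then ((v x.1 x.2 : ℝ) : ℂ) else 0 := by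
    intro x y hx
    rw [hA, blockSuper_apply, if_neg hx, E, Matrix.single_apply]
    by_cases h : x = y
    · subst h; simp
    · have : ¬ (y.1 = x.1 ∧ y.2 = x.2) := fun h' => h (Prod.ext h'.1.symm h'.2.symm)
      simp [h, this]
  have hA1 : ∀ i k : Fin d, A (i, i) (k, k) = ((N i k : ℝ) : ℂ) := by
    intro i k
    rw [hA, blockSuper_apply, if_pos rfl, Finset.sum_eq_single k]
    · simp [E]
    · intro m _ hm; simp [E, hm.symm]
    · simp
  rw [Matrix.charpoly, Matrix.twoBlockTriangular_det _ (fun x : Fin d × Fin d => x.1 = x.2)]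
  · rw [Polynomial.map_mul, mul_comm]
    congr 1
    · have hd : (A.charmatrix.toSquareBlockProp fun x : Fin d × Fin d => ¬ x.1 = x.2)
          = Matrix.diagonal fun x => Polynomial.X - Polynomial.C ((v x.1.1 x.1.2 : ℝ) : ℂ) := by
        ext1 x y
        rw [Matrix.toSquareBlockProp_def, Matrix.of_apply, Matrix.charmatrix_apply, hA0 _ _ x.2,
          Matrix.diagonal_apply, Matrix.diagonal_apply]
        by_cases h : x = y
        · simp [h]
        · have h' : ¬ (x : Fin d × Fin d) = y := fun h' => h (Subtype.ext h')
          simp [h, h']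
      rw [hd, Matrix.det_diagonal]
      rw [Polynomial.map_prod]
      simp_rw [Polynomial.map_prod]
      rw [← Fintype.prod_prod_type' (f := fun i j : Fin d => Polynomial.map (algebraMap ℝ ℂ)
        (if i = j then 1 else (Polynomial.X - Polynomial.C (v i j))))]
      have e : ∀ x : Fin d × Fin d, Polynomial.map (algebraMap ℝ ℂ)
          (if x.1 = x.2 then 1 else (Polynomial.X - Polynomial.C (v x.1 x.2)))
          = if ¬ x.1 = x.2 then (Polynomial.X - Polynomial.C ((v x.1 x.2 : ℝ) : ℂ)) else 1 := by
        intro x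
        by_cases h : x.1 = x.2 <;> simp [h]
      simp_rw [e]
      rw [← Finset.prod_filter, ← Finset.prod_subtype_eq_prod_filter]
      simp
    · let eqv : Fin d ≃ {x : Fin d × Fin d // x.1 = x.2} :=
        ⟨fun i => ⟨(i, i), rfl⟩, fun x => x.1.1, fun i => rfl, fun x => by
          rcases x with ⟨⟨i, j⟩, h⟩
          simp only at h
          subst h
          rfl⟩
      rw [← Matrix.charpoly_map, Matrix.charpoly, ← Matrix.det_submatrix_equiv_self eqv]
      congr 1
      ext1 i k
      rw [Matrix.submatrix_apply, Matrix.toSquareBlockProp_def, Matrix.of_apply,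
        Matrix.charmatrix_apply, Matrix.charmatrix_apply]
      have e1 : A (eqv i : Fin d × Fin d) (eqv k : Fin d × Fin d) = ((N i k : ℝ) : ℂ) := hA1 i k
      rw [e1, Matrix.diagonal_apply, Matrix.diagonal_apply]
      have e2 : ((eqv i : Fin d × Fin d) = eqv k) ↔ i = k := by
        simp [eqv]
      simp [e2]
  · intro x hx y hy
    rw [Matrix.charmatrix_apply, hA0 x y hx, Matrix.diagonal_apply]
    have : x ≠ y := by rintro rfl; exact hx hy
    simp [this]

end BlockSuper

/-! ### Descent from complex operators to the real space of traceless Hermitian operators. -/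

section TracelessHermitian

variable {d : ℕ}

lemma tracelessHermProj_of_mem {X : Op d} (hX : X ∈ tracelessHerm d) :
    (tracelessHermProj d X : Op d) = X := by
  change (1 / 2 : ℝ) • (X + Xᴴ) - (X.trace.re / d) • (1 : Op d) = X
  rw [hX.2, hX.1.eq, Complex.zero_re, zero_div, zero_smul, sub_zero, ← two_smul ℝ, smul_smul]
  norm_num

lemma coe_restrictTH {O : SuperOp d} (hO : ∀ X ∈ tracelessHerm d, O X ∈ tracelessHerm d)
    (x : tracelessHerm d) : (restrictTH O x : Op d) = O x :=
  tracelessHermProj_of_mem (hO _ x.2)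

/-- This is `X = H + i K`, with `H`, `K` the Hermitian parts of `X` and `-i X`, each split into a
traceless part and a multiple of the identity. -/
lemma eq_tracelessHermProj_add (X : Op d) :
    X = ((tracelessHermProj d X : Op d) + ((X.trace.re / d : ℝ) : ℂ) • (1 : Op d))
      + Complex.I • ((tracelessHermProj d ((-Complex.I) • X) : Op d)
        + (((((-Complex.I) • X).trace.re / d : ℝ)) : ℂ) • (1 : Op d)) := by
  have h : ∀ Y : Op d, (tracelessHermProj d Y : Op d) + ((Y.trace.re / d : ℝ) : ℂ) • (1 : Op d)
      = (1 / 2 : ℝ) • (Y + Yᴴ) := by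
    intro Y
    change (1 / 2 : ℝ) • (Y + Yᴴ) - (Y.trace.re / d) • (1 : Op d) + _ = _
    rw [Complex.coe_smul, sub_add_cancel]
  rw [h, h]
  ext i j
  simp only [Matrix.add_apply, Matrix.smul_apply, Matrix.conjTranspose_apply, smul_eq_mul,
    Complex.real_smul, star_mul', Complex.star_def, map_neg, Complex.conj_I]
  push_cast
  linear_combination (1 / 2 * X i j - 1 / 2 * (starRingEnd ℂ) (X j i)) * Complex.I_sq

/-- The trace isolates the coefficient of the identity. The Hermitian part of the remaining relation
is a real relation among the basis vectors and kills the real parts; multiplying by `-i` treats the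
imaginary parts. -/
lemma linearIndependent_tracelessHerm_basis (hd : 0 < d) {ι : Type*} [Fintype ι]
    (B : Module.Basis ι ℝ (tracelessHerm d)) :
    LinearIndependent ℂ (Sum.elim (fun i => (B i : Op d)) (fun _ : Unit => (1 : Op d))) := by
  rw [Fintype.linearIndependent_iff]
  intro c hc
  simp only [Fintype.sum_sum_type, Sum.elim_inl, Sum.elim_inr, Finset.univ_unique,
    Finset.sum_singleton] at hc
  have hd' : (d : ℂ) ≠ 0 := by exact_mod_cast hd.ne'
  have h0 : c (Sum.inr default) = 0 := by
    have ht := congrArg Matrix.trace hc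
    rw [Matrix.trace_add, Matrix.trace_sum, Finset.sum_eq_zero, Matrix.trace_smul,
      Matrix.trace_one, Matrix.trace_zero, Fintype.card_fin, zero_add, smul_eq_mul] at ht
    · exact (mul_eq_zero.1 ht).resolve_right hd'
    · intro i _
      rw [Matrix.trace_smul, (B i).2.2, smul_zero]
  rw [h0, zero_smul, add_zero] at hc
  have hre : ∀ e : ι → ℂ, ∑ i, e i • (B i : Op d) = 0 → ∀ i, (e i).re = 0 := by
    intro e he
    have he2 := congrArg Matrix.conjTranspose he
    rw [Matrix.conjTranspose_sum, Matrix.conjTranspose_zero] at he2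
    have hsum : ∑ i, (e i).re • B i = 0 := by
      apply Subtype.ext
      rw [Submodule.coe_sum, Submodule.coe_zero]
      have e1 : ∀ i, (((e i).re • B i : tracelessHerm d) : Op d)
          = (1 / 2 : ℂ) • (e i • (B i : Op d) + (e i • (B i : Op d))ᴴ) := by
        intro i
        rw [Submodule.coe_smul, Matrix.conjTranspose_smul, (B i).2.1.eq, ← add_smul, smul_smul,
          Complex.star_def, Complex.add_conj]
        push_cast
        rw [← mul_assoc, show (1 / 2 : ℂ) * 2 = 1 by norm_num, one_mul, Complex.coe_smul]
      simp_rw [e1]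
      rw [← Finset.smul_sum, Finset.sum_add_distrib, he, he2, add_zero, smul_zero]
    exact Fintype.linearIndependent_iff.1 B.linearIndependent _ hsum
  have hre1 := hre _ hc
  have him := hre (fun i => -Complex.I * c (Sum.inl i)) (by
    simp_rw [mul_smul]
    rw [← Finset.smul_sum, hc, smul_zero])
  rintro (i | i)
  · apply Complex.ext
    · exact hre1 i
    · simpa using him i
  · exact h0

lemma span_tracelessHerm_basis {ι : Type*} [Fintype ι]
    (B : Module.Basis ι ℝ (tracelessHerm d)) :
    ⊤ ≤ Submodule.span ℂ
      (Set.range (Sum.elim (fun i => (B i : Op d)) (fun _ : Unit => (1 : Op d)))) := by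
  set S := Submodule.span ℂ
      (Set.range (Sum.elim (fun i => (B i : Op d)) (fun _ : Unit => (1 : Op d)))) with hS
  have h1 : (1 : Op d) ∈ S := Submodule.subset_span ⟨Sum.inr (), rfl⟩
  have hB : ∀ y : tracelessHerm d, (y : Op d) ∈ S := by
    intro y
    rw [← B.sum_repr y, Submodule.coe_sum]
    refine Submodule.sum_mem _ fun i _ => ?_
    rw [Submodule.coe_smul, ← Complex.coe_smul]
    exact Submodule.smul_mem _ _ (Submodule.subset_span ⟨Sum.inl i, rfl⟩)
  intro X _
  rw [eq_tracelessHermProj_add X]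
  exact Submodule.add_mem _ (Submodule.add_mem _ (hB _) (Submodule.smul_mem _ _ h1))
    (Submodule.smul_mem _ _ (Submodule.add_mem _ (hB _) (Submodule.smul_mem _ _ h1)))

/-- The operators are the complexification of the Hermitian ones, which split into the traceless
ones and the multiples of the identity. -/
theorem charpoly_restrictTH (hd : 0 < d) {O : SuperOp d}
    (hO : ∀ X ∈ tracelessHerm d, O X ∈ tracelessHerm d) (h1 : O 1 = 0) :
    (restrictTH O).charpoly.map (algebraMap ℝ ℂ) * Polynomial.X = O.charpoly := by
  let B := Module.finBasis ℝ (tracelessHerm d)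
  let b : Module.Basis _ ℂ (Op d) := Module.Basis.mk (linearIndependent_tracelessHerm_basis hd B)
    (span_tracelessHerm_basis B)
  let A := LinearMap.toMatrix B B (restrictTH O)
  -- Invariance and `O 1 = 0` make the matrix block diagonal; the zero `1 × 1` block contributes the
  -- factor `X`.
  have hM : LinearMap.toMatrix b b O = Matrix.fromBlocks (A.map (algebraMap ℝ ℂ)) 0 0 0 := by
    rw [← LinearEquiv.eq_symm_apply, LinearMap.toMatrix_symm]
    refine b.ext fun j => ?_
    rw [Matrix.toLin_self]
    simp only [Fintype.sum_sum_type, b, Module.Basis.mk_apply]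
    rcases j with j | j
    · simp only [Sum.elim_inl, Matrix.fromBlocks_apply₁₁, Matrix.fromBlocks_apply₂₁,
        Matrix.zero_apply, zero_smul, Finset.sum_const_zero, add_zero, Matrix.map_apply]
      rw [← coe_restrictTH hO, ← B.sum_repr (restrictTH O (B j)), Submodule.coe_sum]
      refine Finset.sum_congr rfl fun i _ => ?_
      rw [Submodule.coe_smul]
      change _ = ((LinearMap.toMatrix B B (restrictTH O) i j : ℝ) : ℂ) • _
      rw [LinearMap.toMatrix_apply, Complex.coe_smul]
    · simp [h1]
  rw [← LinearMap.charpoly_toMatrix O b, hM, Matrix.charpoly_fromBlocks_zero₁₂,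
    Matrix.charpoly_map, LinearMap.charpoly_toMatrix]
  simp [Matrix.charpoly, Matrix.charmatrix]

end TracelessHermitian

/-! ### Haar integrals of superoperators and the mean-square-error matrix. -/

section HaarIntegral

variable {d : ℕ}

lemma superOp_apply_apply (G : SuperOp d) (X : Op d) (i j : Fin d) :
    G X i j = ∑ k, ∑ l, X k l * G (E k l) i j := by
  conv_lhs => rw [Matrix.matrix_eq_sum_single X]
  simp only [map_sum, Matrix.sum_apply]
  refine Finset.sum_congr rfl fun k _ => Finset.sum_congr rfl fun l _ => ?_
  rw [show Matrix.single k l (X k l) = X k l • E k l by simp [E, Matrix.smul_single], map_smul,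
    Matrix.smul_apply, smul_eq_mul]

/-- Entries of `G T H` are finite linear combinations of entries of `T`; integrability lets the
integral pass through the sums. -/
lemma haarIntegral_mul_mul (G H : SuperOp d) {T : PureState d → SuperOp d}
    (hT : ∀ k l i j, Integrable (fun ψ => T ψ (E k l) i j) (haarPure d)) :
    haarIntegral (fun ψ => G * T ψ * H) = G * haarIntegral T * H := by
  have key : ∀ (S : SuperOp d) (k l i j : Fin d), (G * S * H) (E k l) i j
      = ∑ i', ∑ j', (∑ k', ∑ l', H (E k l) k' l' * S (E k' l') i' j') * G (E i' j') i j := by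
    intro S k l i j
    rw [Module.End.mul_apply, Module.End.mul_apply, superOp_apply_apply]
    simp_rw [← superOp_apply_apply]
  refine superOp_ext fun k l i j => ?_
  rw [haarIntegral_apply_E, key]
  simp_rw [key, haarIntegral_apply_E]
  have h1 : ∀ i' j' k' l', Integrable (fun ψ => H (E k l) k' l' * T ψ (E k' l') i' j')
      (haarPure d) := fun i' j' k' l' => (hT k' l' i' j').const_mul _
  have h2 : ∀ i' j' k', Integrable (fun ψ => ∑ l', H (E k l) k' l' * T ψ (E k' l') i' j')
      (haarPure d) := fun i' j' k' => integrable_finsetSum _ fun l' _ => h1 i' j' k' l'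
  have h3 : ∀ i' j', Integrable (fun ψ => ∑ k', ∑ l', H (E k l) k' l' * T ψ (E k' l') i' j')
      (haarPure d) := fun i' j' => integrable_finsetSum _ fun k' _ => h2 i' j' k'
  rw [integral_finsetSum _ fun i' _ => integrable_finsetSum _ fun j' _ =>
    (h3 i' j').mul_const _]
  refine Finset.sum_congr rfl fun i' _ => ?_
  rw [integral_finsetSum _ fun j' _ => (h3 i' j').mul_const _]
  refine Finset.sum_congr rfl fun j' _ => ?_
  rw [integral_mul_const, integral_finsetSum _ fun k' _ => h2 i' j' k']
  congr 1
  refine Finset.sum_congr rfl fun k' _ => ?_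
  rw [integral_finsetSum _ fun l' _ => h1 i' j' k' l']
  exact Finset.sum_congr rfl fun l' _ => integral_const_mul _ _

lemma dOuter_map_map {G : SuperOp d}
    (hG : ∀ X Y : Op d, (Xᴴ * G Y).trace = ((G X)ᴴ * Y).trace) (A B : Op d) :
    dOuter (G A) (G B) = G * dOuter A B * G := by
  refine LinearMap.ext fun X => ?_
  rw [Module.End.mul_apply, Module.End.mul_apply, dOuter_apply, dOuter_apply, map_smul, hG]

lemma born_smul_dOuter {p : ℝ} (hp : p ≠ 0) (A : Op d) :
    ((p : ℝ) : ℂ) • dOuter (((p⁻¹ : ℝ) : ℂ) • A) (((p⁻¹ : ℝ) : ℂ) • A)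
      = ((p⁻¹ : ℝ) : ℂ) • dOuter A A := by
  refine LinearMap.ext fun X => ?_
  have hp' : (p : ℂ) ≠ 0 := by exact_mod_cast hp
  rw [LinearMap.smul_apply, LinearMap.smul_apply, dOuter_apply, dOuter_apply,
    Matrix.conjTranspose_smul, Matrix.smul_mul, Matrix.trace_smul, smul_smul, smul_smul,
    smul_smul, Complex.star_def, Complex.conj_ofReal, smul_eq_mul]
  congr 1
  push_cast
  field_simp

lemma frame_integrand_apply (ρ : Op d) (ψ : PureState d) (k l i j : Fin d) :
    ((((born ρ ψ)⁻¹ : ℝ) : ℂ) • dOuter (ketbra ψ) (ketbra ψ)) (E k l) i j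
      = (((born ρ ψ)⁻¹ : ℝ) : ℂ) * monom (pairExp l i) (pairExp k j) ψ.1 := by
  rw [LinearMap.smul_apply, dOuter_apply, trace_conjTranspose_mul_E, monom_pairExp]
  simp only [Matrix.smul_apply, smul_eq_mul, ketbra, Matrix.of_apply]
  rw [mul_comm (star (ψ.1 l))]

lemma integrable_frame_integrand (hd : 0 < d) {ρ : Op d} {w : Fin d → ℝ} (hw : ∀ m, 0 < w m)
    (hρ : ∀ ψ, born ρ ψ = wForm w ψ.1) (k l i j : Fin d) :
    Integrable (fun ψ => ((((born ρ ψ)⁻¹ : ℝ) : ℂ) • dOuter (ketbra ψ) (ketbra ψ)) (E k l) i j)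
      (haarPure d) := by
  have := isProbabilityMeasure_haarPure hd
  simp_rw [frame_integrand_apply, hρ]
  have hc : Continuous fun ψ : PureState d =>
      (((wForm w ψ.1)⁻¹ : ℝ) : ℂ) * monom (pairExp l i) (pairExp k j) ψ.1 := by
    refine Continuous.mul (Complex.continuous_ofReal.comp (Continuous.inv₀
      ((continuous_wForm w).comp continuous_subtype_val) fun ψ => (wForm_pos_sphere hw ψ).ne'))
      ((continuous_monom _ _).comp continuous_subtype_val)
  rw [← integrableOn_univ]
  exact hc.continuousOn.integrableOn_compact isCompact_univ

/-- The mean-square-error matrix of the optimal reconstruction is `F⁻¹ - |ρ⟩⟩⟨⟨ρ|`. -/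
theorem blueMatrix_eq (hd : 0 < d) {ρ : Op d} {w : Fin d → ℝ} (hw : ∀ m, 0 < w m)
    (hρ : ∀ ψ, born ρ ψ = wForm w ψ.1) {G : SuperOp d}
    (hG : ∀ X Y : Op d, (Xᴴ * G Y).trace = ((G X)ᴴ * Y).trace)
    (h1 : frame ρ * G = 1) (h2 : G * frame ρ = 1) :
    blueMatrix ρ = G - dOuter ρ ρ := by
  have hinv : Ring.inverse (frame ρ) = G := Ring.inverse_unit ⟨frame ρ, G, h1, h2⟩
  -- The weight `p_ψ` and the two factors `p_ψ⁻¹` of the reconstruction operators leave `p_ψ⁻¹`, the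
  -- weight of the frame superoperator, so the integral becomes `G F G = G`.
  have e : ∀ ψ, ((born ρ ψ : ℝ) : ℂ) • dOuter (optRec ρ ψ) (optRec ρ ψ)
      = G * ((((born ρ ψ)⁻¹ : ℝ) : ℂ) • dOuter (ketbra ψ) (ketbra ψ)) * G := by
    intro ψ
    have hp : born ρ ψ ≠ 0 := by rw [hρ]; exact (wForm_pos_sphere hw ψ).ne'
    rw [optRec, hinv, born_smul_dOuter hp, dOuter_map_map hG, mul_smul_comm, smul_mul_assoc]
  rw [blueMatrix, mseMatrix]
  simp_rw [e]
  rw [haarIntegral_mul_mul _ _ (integrable_frame_integrand hd hw hρ), ← smul_mul_assoc,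
    ← mul_smul_comm]
  change G * frame ρ * G - _ = _
  rw [h2, one_mul]

end HaarIntegral

/-! ### Block form of the frame and Fisher superoperators. -/

section Frame

variable {d r : ℕ} {s : ℝ}

lemma blk_comm {R : Type*} (x y z : R) (i j : Fin d) : blk d r x y z i j = blk d r x y z j i := by
  unfold blk
  simp only [and_comm]

lemma blockVal_eq (i j : Fin d) :
    blockVal d r s i j = blk d r (aPar d r s) (bPar d r s) (cPar d r s) i j := rfl

/-- Of the two pairings in `pairExp_eq_iff`, `l = k`, `i = j` couples diagonal operators to each
other, while `l = j`, `i = k` returns `E_{kl}` to itself. Both occur when all indices coincide,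
whence the doubled diagonal of `M`. -/
lemma frame_rhoState (hr : 1 ≤ r) (hrd : r < d) (hs0 : 0 ≤ s) (hs1 : s < 1) :
    frame (rhoState d r s) = blockSuper (blockVal d r s) (Mmat d r s) := by
  refine superOp_ext fun k l i j => ?_
  rw [frame, LinearMap.smul_apply, Matrix.smul_apply, haarIntegral_apply_E, smul_eq_mul]
  simp_rw [frame_integrand_apply, born_rhoState]
  have hR : blockSuper (blockVal d r s) (Mmat d r s) (E k l) i j
      = if pairExp l i = pairExp k j then
        (((1 + if l = i then 1 else 0) * blockVal d r s l i : ℝ) : ℂ) else 0 := by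
    rw [blockSuper_apply]
    simp only [pairExp_eq_iff, E, Matrix.single_apply]
    by_cases hij : i = j
    · subst hij
      rw [if_pos rfl]
      by_cases hkl : k = l
      · subst hkl
        rw [Finset.sum_eq_single k]
        · simp only [Mmat, Matrix.of_apply, and_self, if_true, mul_one, true_or]
          rw [blockVal_eq, blockVal_eq, blk_comm]
          simp only [eq_comm]
        · intro m _ hm; simp [hm.symm]
        · simp
      · rw [Finset.sum_eq_zero, if_neg]
        · rintro (h | h)
          · exact hkl h.1.symm
          · exact hkl (h.2.symm.trans h.1.symm)
        · intro m _
          rw [if_neg, mul_zero]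
          rintro ⟨rfl, rfl⟩; exact hkl rfl
    · rw [if_neg hij]
      by_cases h : k = i ∧ l = j
      · obtain ⟨rfl, rfl⟩ := h
        rw [if_pos ⟨rfl, rfl⟩, if_pos (Or.inr ⟨rfl, rfl⟩), if_neg (Ne.symm hij), blockVal_eq,
          blockVal_eq, blk_comm]
        simp
      · rw [if_neg h, if_neg, mul_zero]
        rintro (h' | h')
        · exact hij h'.2
        · exact h ⟨h'.2.symm, h'.1⟩
  rw [hR]
  by_cases h : pairExp l i = pairExp k j
  · rw [if_pos h, ← h]
    exact integral_frame_entry hr hrd hs0 hs1 l i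
  · rw [if_neg h]
    exact integral_monom_inv_wForm_of_ne (by omega) (lamVec_pos hrd hs0 hs1)
      (sum_pairExp l i k j) h

lemma sum_ite_dOuter_apply (c : Fin d → Fin d → Prop) [∀ j k, Decidable (c j k)] (X : Op d)
    (i l : Fin d) :
    (∑ j : Fin d, ∑ k : Fin d, if c j k then dOuter (E j k) (E j k) else 0 : SuperOp d) X i l
      = if c i l then X i l else 0 := by
  have e : ∀ j k, ((if c j k then dOuter (E j k) (E j k) else 0 : SuperOp d) X) i l
      = if j = i then (if k = l then (if c i l then X i l else 0) else 0) else 0 := by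
    intro j k
    by_cases hc : c j k
    · rw [if_pos hc, dOuter_apply, trace_E_conjTranspose_mul, Matrix.smul_apply, E,
        Matrix.single_apply]
      by_cases hj : j = i
      · by_cases hk : k = l
        · subst hj hk; simp [hc]
        · simp [hk]
      · simp [hj]
    · rw [if_neg hc]
      by_cases hj : j = i
      · by_cases hk : k = l
        · subst hj hk; simp [hc]
        · simp [hk]
      · simp [hj]
  simp only [LinearMap.sum_apply, Matrix.sum_apply, e]
  simp

lemma P1_apply (X : Op d) (i j : Fin d) :
    P1 d r X i j = if i ≠ j ∧ i.val < r ∧ j.val < r then X i j else 0 :=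
  sum_ite_dOuter_apply _ X i j

lemma P3_apply (X : Op d) (i j : Fin d) :
    P3 d r X i j = if i ≠ j ∧ r ≤ i.val ∧ r ≤ j.val then X i j else 0 :=
  sum_ite_dOuter_apply _ X i j

lemma P2_apply (X : Op d) (i j : Fin d) :
    P2 d r X i j = (if i.val < r ∧ r ≤ j.val then X i j else 0)
      + if j.val < r ∧ r ≤ i.val then X i j else 0 := by
  have e : P2 d r = (∑ j : Fin d, ∑ k : Fin d,
        if j.val < r ∧ r ≤ k.val then dOuter (E j k) (E j k) else 0)
      + ∑ j : Fin d, ∑ k : Fin d,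
        if k.val < r ∧ r ≤ j.val then dOuter (E j k) (E j k) else 0 := by
    rw [Finset.sum_comm (f := fun j k : Fin d =>
      if k.val < r ∧ r ≤ j.val then dOuter (E j k) (E j k) else 0), P2, ← Finset.sum_add_distrib]
    refine Finset.sum_congr rfl fun j _ => ?_
    rw [← Finset.sum_add_distrib]
    refine Finset.sum_congr rfl fun k _ => ?_
    split_ifs <;> simp
  rw [e, LinearMap.add_apply, Matrix.add_apply, sum_ite_dOuter_apply, sum_ite_dOuter_apply]

lemma diagSuper_apply (N : Matrix (Fin d) (Fin d) ℝ) (X : Op d) (i j : Fin d) :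
    diagSuper N X i j = if i = j then ∑ k, ((N i k : ℝ) : ℂ) * X k k else 0 := by
  simp only [diagSuper, LinearMap.sum_apply, LinearMap.smul_apply, dOuter_apply,
    trace_E_conjTranspose_mul, Matrix.sum_apply, Matrix.smul_apply, smul_eq_mul]
  rw [Finset.sum_eq_single i]
  · by_cases h : i = j
    · subst h; simp [E]
    · rw [if_neg h, Finset.sum_eq_zero]
      intro k _
      simp [E, h]
  · intro b _ hb
    refine Finset.sum_eq_zero fun k _ => ?_
    simp [E, hb]
  · simp

lemma blockSuper_eq_sum (x y z : ℝ) (N : Matrix (Fin d) (Fin d) ℝ) :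
    blockSuper (blk d r x y z) N = ((x : ℝ) : ℂ) • P1 d r + ((y : ℝ) : ℂ) • P2 d r
      + ((z : ℝ) : ℂ) • P3 d r + diagSuper N := by
  refine LinearMap.ext fun X => ?_
  ext i j
  simp only [LinearMap.add_apply, LinearMap.smul_apply, Matrix.add_apply, Matrix.smul_apply,
    P1_apply, P2_apply, P3_apply, diagSuper_apply, blockSuper_apply, smul_eq_mul]
  by_cases hij : i = j
  · subst hij
    have h : ¬ (i.val < r ∧ r ≤ i.val) := by omega
    simp [h]
  · unfold blk
    by_cases hi : i.val < r <;> by_cases hj : j.val < r <;>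
      simp [hij, hi, hj, not_lt.1, not_le.2]

lemma tracelessProj_eq : tracelessProj d = blockSuper (fun _ _ => 1) (Ibar d) := by
  refine LinearMap.ext fun X => ?_
  ext i j
  rw [tracelessProj, LinearMap.sub_apply, LinearMap.smul_apply, dOuter_apply, blockSuper_apply]
  simp only [Module.End.one_apply, Matrix.conjTranspose_one, one_mul, Matrix.sub_apply,
    Matrix.smul_apply, smul_eq_mul, Ibar, Matrix.of_apply, Matrix.one_apply]
  by_cases hij : i = j
  · subst hij
    simp only [if_true, mul_one]
    push_cast
    simp only [sub_mul, Finset.sum_sub_distrib, apply_ite Complex.ofReal, Complex.ofReal_one,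
      Complex.ofReal_zero, ite_mul, one_mul, zero_mul, Finset.sum_ite_eq, Finset.mem_univ, if_true]
    rw [← Finset.mul_sum, Matrix.trace]
    rfl
  · simp [hij]

lemma Ibar_eq_bm : Ibar d = bm d r 1 1 (-(d : ℝ)⁻¹) (-(d : ℝ)⁻¹) (-(d : ℝ)⁻¹) (-(d : ℝ)⁻¹) := by
  ext i j
  simp only [Ibar, bm, Matrix.sub_apply, Matrix.smul_apply, Matrix.of_apply, Matrix.one_apply,
    ite_self, smul_eq_mul, mul_one]
  ring

lemma Mmat_eq_bm : Mmat d r s = bm d r (aPar d r s) (cPar d r s) (aPar d r s) (bPar d r s)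
    (bPar d r s) (cPar d r s) := by
  ext i j
  simp only [Mmat, bm, Matrix.of_apply, blockVal]
  by_cases hij : i = j
  · subst hij
    by_cases hi : i.val < r
    · simp [hi]; ring
    · simp [hi, not_lt.1 hi]; ring
  · by_cases hi : i.val < r <;> by_cases hj : j.val < r <;>
      simp [hij, hi, hj, not_lt.1, not_le.2]

/-- Here `β` is the Rayleigh quotient of `M` at the vector equal to `d - r` on the first block and
`-r` on the second. The equality is checked on the block coefficients. -/
lemma Mbar_eq (hr : 1 ≤ r) (hrd : r < d) :
    Mbar d r s = specMat d r (aPar d r s) (cPar d r s) (betaPar d r s) := by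
  have hr' : (r : ℝ) ≠ 0 := by exact_mod_cast (by omega : r ≠ 0)
  have hd' : (d : ℝ) ≠ 0 := by exact_mod_cast (by omega : d ≠ 0)
  have hn' : (d : ℝ) - r ≠ 0 := sub_ne_zero.2 (by exact_mod_cast hrd.ne')
  rw [Mbar, Ibar_eq_bm (r := r), Mmat_eq_bm, bm_mul hrd.le, bm_mul hrd.le, specMat, betaPar]
  congr 1 <;> field_simp <;> ring

lemma fisher_rhoState (hr : 1 ≤ r) (hrd : r < d) (hs0 : 0 ≤ s) (hs1 : s < 1) :
    fisher (rhoState d r s) = blockSuper (blockVal d r s) (Mbar d r s) := by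
  rw [fisher, frame_rhoState hr hrd hs0 hs1, tracelessProj_eq, blockSuper_mul, blockSuper_mul, Mbar]
  simp only [one_mul, mul_one]

lemma isSymm_specMat (x y z : ℝ) : (specMat d r x y z).IsSymm := by
  ext i j
  simp only [specMat, bm, Matrix.transpose_apply, Matrix.of_apply]
  by_cases hij : i = j
  · subst hij; rfl
  · by_cases hi : i.val < r <;> by_cases hj : j.val < r <;> simp [hij, Ne.symm hij, hi, hj]

lemma sum_specMat (hr : 1 ≤ r) (hrd : r < d) (x y z : ℝ) (i : Fin d) :
    ∑ k, specMat d r x y z i k = 0 := by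
  have hr' : (r : ℝ) ≠ 0 := by exact_mod_cast (by omega : r ≠ 0)
  have hd' : (d : ℝ) ≠ 0 := by exact_mod_cast (by omega : d ≠ 0)
  have hn' : (d : ℝ) - r ≠ 0 := sub_ne_zero.2 (by exact_mod_cast hrd.ne')
  simp only [specMat, bm, Matrix.of_apply, Finset.sum_add_distrib, Finset.sum_ite_eq,
    Finset.mem_univ, if_true]
  by_cases hi : i.val < r
  · simp only [hi, if_true]
    rw [sum_block hrd.le]
    field_simp
    ring
  · simp only [hi, if_false]
    rw [sum_block hrd.le]
    field_simp
    ring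

lemma blockSuper_apply_one {v : Fin d → Fin d → ℝ} {N : Matrix (Fin d) (Fin d) ℝ}
    (hN : ∀ i, ∑ k, N i k = 0) : blockSuper v N 1 = 0 := by
  ext i j
  rw [blockSuper_apply]
  by_cases hij : i = j
  · subst hij
    simp only [if_true, Matrix.one_apply_eq, mul_one, Matrix.zero_apply]
    rw [← Complex.ofReal_sum, hN, Complex.ofReal_zero]
  · simp [hij]

lemma blockSuper_mem_tracelessHerm {v : Fin d → Fin d → ℝ} {N : Matrix (Fin d) (Fin d) ℝ}
    (hv : ∀ i j, v i j = v j i) (hN : ∀ k, ∑ i, N i k = 0) {X : Op d}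
    (hX : X ∈ tracelessHerm d) : blockSuper v N X ∈ tracelessHerm d := by
  have hX1 : ∀ i j, star (X j i) = X i j := fun i j => hX.1.apply i j
  constructor
  · ext i j
    rw [Matrix.conjTranspose_apply, blockSuper_apply, blockSuper_apply]
    by_cases hij : i = j
    · subst hij
      rw [if_pos rfl, star_sum]
      refine Finset.sum_congr rfl fun k _ => ?_
      rw [star_mul', hX1, Complex.star_def, Complex.conj_ofReal]
    · rw [if_neg hij, if_neg (Ne.symm hij), star_mul', hX1, Complex.star_def,
        Complex.conj_ofReal, hv]
  · rw [Matrix.trace]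
    simp only [Matrix.diag_apply, blockSuper_apply, if_true]
    rw [Finset.sum_comm]
    refine Finset.sum_eq_zero fun k _ => ?_
    rw [← Finset.sum_mul, ← Complex.ofReal_sum, hN, Complex.ofReal_zero, zero_mul]

end Frame

/-! ### Relations between the parameters and the inverse of `M`. -/

section Parameters

variable {d r : ℕ} {s : ℝ}

lemma aPar_eq (hr : 1 ≤ r) (hrd : r < d) (hs0 : 0 ≤ s) (hs1 : s < 1) :
    aPar d r s = hInt (lam1 d r s) (lam2 d s) (r + 2) (d - r) :=
  g_eq_hInt hr hrd hs0 hs1 rfl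

lemma bPar_eq (hr : 1 ≤ r) (hrd : r < d) (hs0 : 0 ≤ s) (hs1 : s < 1) :
    bPar d r s = hInt (lam1 d r s) (lam2 d s) (r + 1) (d - r + 1) :=
  g_eq_hInt hr hrd hs0 hs1 rfl

lemma cPar_eq (hr : 1 ≤ r) (hrd : r < d) (hs0 : 0 ≤ s) (hs1 : s < 1) :
    cPar d r s = hInt (lam1 d r s) (lam2 d s) r (d - r + 2) :=
  g_eq_hInt hr hrd hs0 hs1 rfl

lemma aPar_pos (hr : 1 ≤ r) (hrd : r < d) (hs0 : 0 ≤ s) (hs1 : s < 1) : 0 < aPar d r s := by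
  rw [aPar_eq hr hrd hs0 hs1]
  exact hInt_pos (lam1_pos hrd hs0 hs1) (lam2_pos hrd hs1) (by omega)

lemma bPar_pos (hr : 1 ≤ r) (hrd : r < d) (hs0 : 0 ≤ s) (hs1 : s < 1) : 0 < bPar d r s := by
  rw [bPar_eq hr hrd hs0 hs1]
  exact hInt_pos (lam1_pos hrd hs0 hs1) (lam2_pos hrd hs1) (by omega)

lemma cPar_pos (hr : 1 ≤ r) (hrd : r < d) (hs0 : 0 ≤ s) (hs1 : s < 1) : 0 < cPar d r s := by
  rw [cPar_eq hr hrd hs0 hs1]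
  exact hInt_pos (lam1_pos hrd hs0 hs1) (lam2_pos hrd hs1) (by omega)

/-- One has `d β = (d - r) a + r c + r (d - r) (a + c - 2 b)`, and `b² ≤ a c` gives `2 b ≤ a + c`.
-/
lemma betaPar_pos (hr : 1 ≤ r) (hrd : r < d) (hs0 : 0 ≤ s) (hs1 : s < 1) :
    0 < betaPar d r s := by
  have ha := aPar_pos hr hrd hs0 hs1
  have hc := cPar_pos hr hrd hs0 hs1
  have hsq := hInt_sq_le (lam1_pos hrd hs0 hs1) (lam2_pos hrd hs1) r (d - r)
  rw [← aPar_eq hr hrd hs0 hs1, ← bPar_eq hr hrd hs0 hs1, ← cPar_eq hr hrd hs0 hs1] at hsq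
  have h2 : 2 * bPar d r s ≤ aPar d r s + cPar d r s := by
    refine le_of_sq_le_sq ?_ (by positivity)
    nlinarith [sq_nonneg (aPar d r s - cPar d r s)]
  have hr' : (0 : ℝ) < r := by exact_mod_cast hr
  have hn' : (0 : ℝ) < (d : ℝ) - r := sub_pos.2 (by exact_mod_cast hrd)
  refine div_pos ?_ (by linarith)
  have h3 := mul_nonneg (mul_pos hr' hn').le (sub_nonneg.2 h2)
  have h4 := mul_pos hn' ha
  have h5 := mul_pos hr' hc
  linarith

lemma trace_lam (hr : 1 ≤ r) (hrd : r < d) : r * lam1 d r s + ((d : ℝ) - r) * lam2 d s = 1 := by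
  have hr' : (r : ℝ) ≠ 0 := by exact_mod_cast (by omega : r ≠ 0)
  have hd' : (d : ℝ) ≠ 0 := by exact_mod_cast (by omega : d ≠ 0)
  unfold lam1 lam2
  field_simp
  ring

/-- Together with `bPar_cPar_relation` this says `M λ = 𝟙` for the vector `λ` of eigenvalues, that
is, `F(ρ)` maps `ρ` to the identity. -/
lemma aPar_bPar_relation (hr : 1 ≤ r) (hrd : r < d) (hs0 : 0 ≤ s) (hs1 : s < 1) :
    (r + 1) * lam1 d r s * aPar d r s + ((d : ℝ) - r) * lam2 d s * bPar d r s = 1 := by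
  have h := hInt_linear_relation (lam1_pos hrd hs0 hs1) (lam2_pos hrd hs1) r (d - r)
  rwa [← aPar_eq hr hrd hs0 hs1, ← bPar_eq hr hrd hs0 hs1, Nat.cast_sub hrd.le] at h

lemma bPar_cPar_relation (hr : 1 ≤ r) (hrd : r < d) (hs0 : 0 ≤ s) (hs1 : s < 1) :
    r * lam1 d r s * bPar d r s + ((d : ℝ) - r + 1) * lam2 d s * cPar d r s = 1 := by
  have h := hInt_linear_relation (lam2_pos hrd hs1) (lam1_pos hrd hs0 hs1) (d - r) r
  rw [hInt_comm, ← cPar_eq hr hrd hs0 hs1, hInt_comm, ← bPar_eq hr hrd hs0 hs1,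
    Nat.cast_sub hrd.le] at h
  linarith

/-- This is Cramer's rule for the two linear relations in `λ₁`, `λ₂`; the unit trace of `ρ`
identifies their determinant as `d β`. -/
lemma lam1_eq (hr : 1 ≤ r) (hrd : r < d) (hs0 : 0 ≤ s) (hs1 : s < 1) :
    lam1 d r s = (betaPar d r s)⁻¹ * (d : ℝ)⁻¹ *
      (((d : ℝ) - r + 1) * cPar d r s - (d - r) * bPar d r s) := by
  have hd' : (d : ℝ) ≠ 0 := by exact_mod_cast (by omega : d ≠ 0)
  have hb := (betaPar_pos hr hrd hs0 hs1).ne'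
  rw [← mul_inv, eq_inv_mul_iff_mul_eq₀ (mul_ne_zero hb hd'), betaPar, div_mul_cancel₀ _ hd']
  linear_combination ((d : ℝ) - r) * (aPar_bPar_relation hr hrd hs0 hs1)
    - ((d : ℝ) - r) * (bPar_cPar_relation hr hrd hs0 hs1)
    + (((d : ℝ) - r + 1) * cPar d r s - (d - r) * bPar d r s) * (trace_lam hr hrd (s := s))

lemma lam2_eq (hr : 1 ≤ r) (hrd : r < d) (hs0 : 0 ≤ s) (hs1 : s < 1) :
    lam2 d s = (betaPar d r s)⁻¹ * (d : ℝ)⁻¹ * ((r + 1) * aPar d r s - r * bPar d r s) := by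
  have hd' : (d : ℝ) ≠ 0 := by exact_mod_cast (by omega : d ≠ 0)
  have hb := (betaPar_pos hr hrd hs0 hs1).ne'
  rw [← mul_inv, eq_inv_mul_iff_mul_eq₀ (mul_ne_zero hb hd'), betaPar, div_mul_cancel₀ _ hd']
  linear_combination -(r : ℝ) * (aPar_bPar_relation hr hrd hs0 hs1)
    + (r : ℝ) * (bPar_cPar_relation hr hrd hs0 hs1)
    + ((r + 1) * aPar d r s - r * bPar d r s) * (trace_lam hr hrd (s := s))

/-- The pseudoinverse of `M̄`. -/
def pinvMat (d r : ℕ) (s : ℝ) : Matrix (Fin d) (Fin d) ℝ :=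
  specMat d r (aPar d r s)⁻¹ (cPar d r s)⁻¹ (betaPar d r s)⁻¹

/-- The inverse of `M`. -/
def invMat (d r : ℕ) (s : ℝ) : Matrix (Fin d) (Fin d) ℝ :=
  pinvMat d r s + Matrix.vecMulVec (lamVec d r s) (lamVec d r s)

lemma isSymm_invMat : (invMat d r s).IsSymm := by
  refine (isSymm_specMat _ _ _).add ?_
  ext i j
  rw [Matrix.transpose_apply, Matrix.vecMulVec_apply, Matrix.vecMulVec_apply, mul_comm]

/-- Since `M` is symmetric with `M λ = 𝟙` and the `λ_i` sum to `1`, the matrix `M⁻¹ - λ λᵀ`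
annihilates `𝟙` and inverts `M̄` on its complement: `M̄ (M⁻¹ - λ λᵀ) = Ī (1 - 𝟙 λᵀ) = Ī`. The
formula this suggests is verified coefficient by coefficient. -/
lemma Mmat_mul_invMat (hr : 1 ≤ r) (hrd : r < d) (hs0 : 0 ≤ s) (hs1 : s < 1) :
    Mmat d r s * invMat d r s = 1 := by
  have h1 := lam1_eq hr hrd hs0 hs1
  have h2 := lam2_eq hr hrd hs0 hs1
  have htr := trace_lam hr hrd (s := s)
  have rel1 := aPar_bPar_relation hr hrd hs0 hs1
  have rel2 := bPar_cPar_relation hr hrd hs0 hs1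
  have ha := mul_inv_cancel₀ (aPar_pos hr hrd hs0 hs1).ne'
  have hc := mul_inv_cancel₀ (cPar_pos hr hrd hs0 hs1).ne'
  have hR := mul_inv_cancel₀ (show (r : ℝ) ≠ 0 by exact_mod_cast (by omega : r ≠ 0))
  have hN := mul_inv_cancel₀ (show (d : ℝ) - r ≠ 0 from sub_ne_zero.2 (by exact_mod_cast hrd.ne'))
  have e : invMat d r s = bm d r (aPar d r s)⁻¹ (cPar d r s)⁻¹
      (-((aPar d r s)⁻¹ / r) + (betaPar d r s)⁻¹ * (d - r) / (d * r) + lam1 d r s * lam1 d r s)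
      (-((betaPar d r s)⁻¹ / d) + lam1 d r s * lam2 d s)
      (-((betaPar d r s)⁻¹ / d) + lam2 d s * lam1 d r s)
      (-((cPar d r s)⁻¹ / (d - r)) + (betaPar d r s)⁻¹ * r / (d * (d - r))
        + lam2 d s * lam2 d s) := by
    ext i j
    simp only [invMat, pinvMat, specMat, bm, Matrix.add_apply, Matrix.of_apply,
      Matrix.vecMulVec_apply, lamVec]
    by_cases hi : i.val < r <;> by_cases hj : j.val < r <;> simp [hi, hj] <;> ring
  rw [Mmat_eq_bm, e, bm_mul hrd.le, ← bm_one d r]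
  generalize aPar d r s = a at *
  generalize bPar d r s = b at *
  generalize cPar d r s = c at *
  generalize betaPar d r s = β at *
  generalize lam1 d r s = l₁ at *
  generalize lam2 d s = l₂ at *
  generalize (d : ℝ) - r = n at *
  -- The coefficients `a a⁻¹` and `c c⁻¹` are settled by `ha` and `hc`; the four block constants
  -- remain.
  congr 1
  · linear_combination (1 - (1 + r) * (r : ℝ)⁻¹) * ha + l₁ * rel1 - n * (r : ℝ)⁻¹ * h2
      + n * (β⁻¹ * (d : ℝ)⁻¹) * b * hR + (r : ℝ)⁻¹ * htr - (1 + l₁) * hR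
  · linear_combination -b * c⁻¹ * hN + r * (β⁻¹ * (d : ℝ)⁻¹) * b * hN + l₂ * rel1 + h2
  · linear_combination -b * a⁻¹ * hR + n * (β⁻¹ * (d : ℝ)⁻¹) * b * hR + l₁ * rel2 + h1
  · linear_combination (1 - (1 + n) * n⁻¹) * hc + l₂ * rel2 - r * n⁻¹ * h1
      + r * (β⁻¹ * (d : ℝ)⁻¹) * b * hN + n⁻¹ * htr - (1 + l₂) * hN

end Parameters

/-! ### Mean-square error, Bures distance and volume of the uncertainty ellipsoid. -/

section Estimation

variable {d r : ℕ} {s : ℝ}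

/-- The entries of the inverse frame superoperator off the diagonal. -/
def invVal (d r : ℕ) (s : ℝ) : Fin d → Fin d → ℝ :=
  blk d r (aPar d r s)⁻¹ (bPar d r s)⁻¹ (cPar d r s)⁻¹

lemma blockVal_mul_invVal (hr : 1 ≤ r) (hrd : r < d) (hs0 : 0 ≤ s) (hs1 : s < 1) (i j : Fin d) :
    blockVal d r s i j * invVal d r s i j = 1 := by
  unfold blockVal invVal blk
  split_ifs
  · exact mul_inv_cancel₀ (aPar_pos hr hrd hs0 hs1).ne'
  · exact mul_inv_cancel₀ (cPar_pos hr hrd hs0 hs1).ne'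
  · exact mul_inv_cancel₀ (bPar_pos hr hrd hs0 hs1).ne'

lemma frame_mul_inv (hr : 1 ≤ r) (hrd : r < d) (hs0 : 0 ≤ s) (hs1 : s < 1) :
    frame (rhoState d r s) * blockSuper (invVal d r s) (invMat d r s) = 1 := by
  rw [frame_rhoState hr hrd hs0 hs1, blockSuper_mul, Mmat_mul_invMat hr hrd hs0 hs1]
  simp_rw [blockVal_mul_invVal hr hrd hs0 hs1]
  exact blockSuper_one

lemma inv_mul_frame (hr : 1 ≤ r) (hrd : r < d) (hs0 : 0 ≤ s) (hs1 : s < 1) :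
    blockSuper (invVal d r s) (invMat d r s) * frame (rhoState d r s) = 1 := by
  rw [frame_rhoState hr hrd hs0 hs1, blockSuper_mul,
    mul_eq_one_comm.1 (Mmat_mul_invMat hr hrd hs0 hs1)]
  simp_rw [mul_comm (invVal d r s _ _), blockVal_mul_invVal hr hrd hs0 hs1]
  exact blockSuper_one

lemma dOuter_rhoState : dOuter (rhoState d r s) (rhoState d r s)
    = blockSuper (fun _ _ => 0) (Matrix.vecMulVec (lamVec d r s) (lamVec d r s)) := by
  refine LinearMap.ext fun X => ?_
  ext i j
  rw [dOuter_apply, blockSuper_apply, rhoState_eq, Matrix.diagonal_conjTranspose,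
    Matrix.smul_apply, Matrix.diagonal_apply]
  by_cases hij : i = j
  · subst hij
    rw [if_pos rfl, if_pos rfl, smul_eq_mul, Matrix.trace, Finset.sum_mul]
    refine Finset.sum_congr rfl fun k _ => ?_
    rw [Matrix.diag_apply, Matrix.diagonal_mul, Matrix.vecMulVec_apply, Pi.star_apply,
      Complex.star_def, Complex.conj_ofReal]
    push_cast
    ring
  · simp [hij]

/-- Subtracting `|ρ⟩⟩⟨⟨ρ|` removes exactly the term `λ λᵀ` of the inverse, leaving the pseudoinverse
of the Fisher superoperator. -/
theorem blueMatrix_rhoState (hr : 1 ≤ r) (hrd : r < d) (hs0 : 0 ≤ s) (hs1 : s < 1) :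
    blueMatrix (rhoState d r s) = blockSuper (invVal d r s) (pinvMat d r s) := by
  rw [blueMatrix_eq (by omega) (lamVec_pos hrd hs0 hs1) (born_rhoState d r s)
    (blockSuper_symm _ _ isSymm_invMat) (frame_mul_inv hr hrd hs0 hs1)
    (inv_mul_frame hr hrd hs0 hs1), dOuter_rhoState, blockSuper_sub]
  refine blockSuper_congr (fun i j _ => sub_zero _) ?_
  rw [invMat, add_sub_cancel_right]

theorem scaledMSE_rhoState (hr : 1 ≤ r) (hrd : r < d) (hs0 : 0 ≤ s) (hs1 : s < 1) :
    scaledMSE (rhoState d r s) =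
      ((r : ℝ) ^ 2 - 1) / aPar d r s + 2 * r * ((d : ℝ) - r) / bPar d r s
        + (((d : ℝ) - r) ^ 2 - 1) / cPar d r s + 1 / betaPar d r s := by
  have hd' : (d : ℝ) ≠ 0 := by exact_mod_cast (by omega : d ≠ 0)
  have h := trace_specMat_weighted hr hrd (aPar d r s)⁻¹ (cPar d r s)⁻¹ (betaPar d r s)⁻¹ 1 1
  simp only [ite_self, one_mul, mul_one] at h
  rw [scaledMSE, scaledWMSE, one_mul, blueMatrix_rhoState hr hrd hs0 hs1, trace_blockSuper,
    Complex.ofReal_re, invVal, sum_offDiag_blk hrd.le, pinvMat, h]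
  simp only [div_eq_mul_inv]
  linear_combination (betaPar d r s)⁻¹ * mul_inv_cancel₀ hd'

lemma buresWeight_rhoState (hrd : r < d) (hs0 : 0 ≤ s) (hs1 : s < 1) :
    buresWeight (rhoState d r s) = (1 / 2 : ℂ) • blockSuper
      (fun i j => (lamVec d r s i + lamVec d r s j)⁻¹)
      (Matrix.diagonal fun i => (lamVec d r s i + lamVec d r s i)⁻¹) := by
  have hpos := lamVec_pos hrd hs0 hs1
  have h : LinearMap.mulLeft ℂ (rhoState d r s) + LinearMap.mulRight ℂ (rhoState d r s)
      = blockSuper (fun i j => lamVec d r s i + lamVec d r s j)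
        (Matrix.diagonal fun i => lamVec d r s i + lamVec d r s i) := by
    refine LinearMap.ext fun X => ?_
    ext i j
    rw [LinearMap.add_apply, LinearMap.mulLeft_apply, LinearMap.mulRight_apply, rhoState_eq,
      Matrix.add_apply, Matrix.diagonal_mul, Matrix.mul_diagonal, blockSuper_apply]
    by_cases hij : i = j
    · subst hij
      rw [if_pos rfl, Finset.sum_eq_single i]
      · rw [Matrix.diagonal_apply_eq]
        push_cast
        ring
      · intro k _ hk
        rw [Matrix.diagonal_apply_ne _ hk.symm, Complex.ofReal_zero, zero_mul]
      · simp
    · rw [if_neg hij]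
      push_cast
      ring
  have hne : ∀ i j, lamVec d r s i + lamVec d r s j ≠ 0 := fun i j =>
    (add_pos (hpos i) (hpos j)).ne'
  rw [buresWeight, h]
  congr 1
  have hl : blockSuper (fun i j => lamVec d r s i + lamVec d r s j)
        (Matrix.diagonal fun i => lamVec d r s i + lamVec d r s i) *
      blockSuper (fun i j => (lamVec d r s i + lamVec d r s j)⁻¹)
        (Matrix.diagonal fun i => (lamVec d r s i + lamVec d r s i)⁻¹) = 1 := by
    rw [blockSuper_mul, Matrix.diagonal_mul_diagonal]
    simp_rw [mul_inv_cancel₀ (hne _ _)]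
    rw [Matrix.diagonal_one]
    exact blockSuper_one
  have hr : blockSuper (fun i j => (lamVec d r s i + lamVec d r s j)⁻¹)
        (Matrix.diagonal fun i => (lamVec d r s i + lamVec d r s i)⁻¹) *
      blockSuper (fun i j => lamVec d r s i + lamVec d r s j)
        (Matrix.diagonal fun i => lamVec d r s i + lamVec d r s i) = 1 := by
    rw [blockSuper_mul, Matrix.diagonal_mul_diagonal]
    simp_rw [inv_mul_cancel₀ (hne _ _)]
    rw [Matrix.diagonal_one]
    exact blockSuper_one
  exact Ring.inverse_unit ⟨_, _, hl, hr⟩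

theorem scaledMSB_rhoState (hr : 1 ≤ r) (hrd : r < d) (hs0 : 0 ≤ s) (hs1 : s < 1) :
    scaledMSB (rhoState d r s) =
      (1 / 4) * (((r : ℝ) ^ 2 - 1) / (aPar d r s * lam1 d r s)
        + 4 * r * ((d : ℝ) - r) / (bPar d r s * (lam1 d r s + lam2 d s))
        + (((d : ℝ) - r) ^ 2 - 1) / (cPar d r s * lam2 d s)
        + ((d : ℝ) - r) / (d * betaPar d r s * lam1 d r s)
        + r / (d * betaPar d r s * lam2 d s)) := by
  have e : blockSuper (fun i j => (lamVec d r s i + lamVec d r s j)⁻¹)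
        (Matrix.diagonal fun i => (lamVec d r s i + lamVec d r s i)⁻¹) *
        blockSuper (invVal d r s) (pinvMat d r s)
      = blockSuper (blk d r ((aPar d r s)⁻¹ * (lam1 d r s + lam1 d r s)⁻¹)
          ((bPar d r s)⁻¹ * (lam1 d r s + lam2 d s)⁻¹)
          ((cPar d r s)⁻¹ * (lam2 d s + lam2 d s)⁻¹))
        (Matrix.diagonal (fun i => (lamVec d r s i + lamVec d r s i)⁻¹) * pinvMat d r s) := by
    rw [blockSuper_mul]
    refine blockSuper_congr (fun i j _ => ?_) rfl
    simp only [invVal, blk, lamVec]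
    by_cases hi : i.val < r <;> by_cases hj : j.val < r <;>
      simp [hi, hj, not_lt.1, not_le.2, mul_comm, add_comm]
  have hdiag : ∑ i, (Matrix.diagonal (fun i => (lamVec d r s i + lamVec d r s i)⁻¹) *
      pinvMat d r s) i i = ∑ i : Fin d, (if i.val < r then (lam1 d r s + lam1 d r s)⁻¹
        else (lam2 d s + lam2 d s)⁻¹) * pinvMat d r s i i := by
    refine Finset.sum_congr rfl fun i _ => ?_
    rw [Matrix.diagonal_mul, lamVec]
    split_ifs <;> rfl
  rw [scaledMSB, scaledWMSE, blueMatrix_rhoState hr hrd hs0 hs1,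
    buresWeight_rhoState hrd hs0 hs1, smul_mul_assoc, e, map_smul, trace_blockSuper, smul_eq_mul,
    show (1 / 2 : ℂ) = ((1 / 2 : ℝ) : ℂ) by push_cast; rfl, ← Complex.ofReal_mul,
    Complex.ofReal_re, sum_offDiag_blk hrd.le, hdiag, pinvMat, trace_specMat_weighted hr hrd]
  have hd' : (d : ℝ) ≠ 0 := by exact_mod_cast (by omega : d ≠ 0)
  have h1 := (lam1_pos hrd hs0 hs1 (r := r)).ne'
  have h2 := (lam2_pos hrd hs1 (r := r)).ne'
  have h3 := (add_pos (lam1_pos hrd hs0 hs1 (r := r)) (lam2_pos hrd hs1 (r := r))).ne'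
  have ha := (aPar_pos hr hrd hs0 hs1).ne'
  have hb := (bPar_pos hr hrd hs0 hs1).ne'
  have hc := (cPar_pos hr hrd hs0 hs1).ne'
  have hβ := (betaPar_pos hr hrd hs0 hs1).ne'
  rw [← two_mul, ← two_mul]
  generalize aPar d r s = a at *
  generalize bPar d r s = b at *
  generalize cPar d r s = c at *
  generalize betaPar d r s = β at *
  generalize lam1 d r s = l₁ at *
  generalize lam2 d s = l₂ at *
  generalize (d : ℝ) - r = n at *
  field_simp
  ring

/-- The multiplicity `r² - 1` collects `r (r - 1)` off-diagonal operators and `r - 1` diagonal ones,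
likewise in the second block. The factor `X` of the identity direction is cancelled over `ℝ`. -/
theorem charpoly_restrictTH_blockSuper (hr : 1 ≤ r) (hrd : r < d) (x y z β : ℝ) :
    (restrictTH (blockSuper (blk d r x y z) (specMat d r x z β))).charpoly =
      (Polynomial.X - Polynomial.C x) ^ (r ^ 2 - 1)
        * (Polynomial.X - Polynomial.C y) ^ (2 * r * (d - r))
        * (Polynomial.X - Polynomial.C z) ^ ((d - r) ^ 2 - 1)
        * (Polynomial.X - Polynomial.C β) := by
  have hmem : ∀ X ∈ tracelessHerm d,
      blockSuper (blk d r x y z) (specMat d r x z β) X ∈ tracelessHerm d := fun X hX =>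
    blockSuper_mem_tracelessHerm (blk_comm x y z) (fun k => by
      simp_rw [fun i => (isSymm_specMat (d := d) (r := r) x z β).apply k i]
      exact sum_specMat hr hrd x z β k) hX
  have h := charpoly_restrictTH (by omega) hmem (blockSuper_apply_one (sum_specMat hr hrd x z β))
  have eprod : (∏ i : Fin d, ∏ j : Fin d, if i = j then 1 else
      (Polynomial.X - Polynomial.C (blk d r x y z i j)))
      = (Polynomial.X - Polynomial.C x) ^ (r * (r - 1))
        * (Polynomial.X - Polynomial.C y) ^ (2 * r * (d - r))
        * (Polynomial.X - Polynomial.C z) ^ ((d - r) * (d - r - 1)) := by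
    rw [← prod_offDiag_blk hrd.le]
    refine Finset.prod_congr rfl fun i _ => Finset.prod_congr rfl fun j _ => ?_
    unfold blk
    split_ifs <;> rfl
  rw [charpoly_blockSuper, eprod, charpoly_specMat hr hrd, ← Polynomial.map_X (algebraMap ℝ ℂ),
    ← Polynomial.map_mul] at h
  have h' := Polynomial.map_injective _ (algebraMap ℝ ℂ).injective h
  apply mul_right_cancel₀ (Polynomial.X_ne_zero (R := ℝ))
  rw [h']
  obtain ⟨m, rfl⟩ : ∃ m, r = m + 1 := ⟨r - 1, by omega⟩
  obtain ⟨n, hn⟩ : ∃ n, d - (m + 1) = n + 1 := ⟨d - (m + 1) - 1, by omega⟩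
  rw [hn, show (m + 1) ^ 2 - 1 = (m + 1) * m + m by
      rw [show (m + 1) ^ 2 = (m + 1) * m + m + 1 by ring, Nat.add_sub_cancel],
    show (n + 1) ^ 2 - 1 = (n + 1) * n + n by
      rw [show (n + 1) ^ 2 = (n + 1) * n + n + 1 by ring, Nat.add_sub_cancel]]
  simp only [Nat.add_sub_cancel, pow_add]
  ring

lemma det_restrictTH_blockSuper (hr : 1 ≤ r) (hrd : r < d) (x y z β : ℝ) :
    LinearMap.det (restrictTH (blockSuper (blk d r x y z) (specMat d r x z β))) =
      x ^ (r ^ 2 - 1) * y ^ (2 * r * (d - r)) * z ^ ((d - r) ^ 2 - 1) * β := by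
  have h := charpoly_restrictTH_blockSuper hr hrd x y z β
  -- The degree of the product is the dimension of the real space, which fixes the sign between
  -- determinant and constant coefficient.
  have hdeg := congrArg Polynomial.natDegree h
  rw [LinearMap.charpoly_natDegree] at hdeg
  have hm : ∀ (t : ℝ) (k : ℕ), ((Polynomial.X - Polynomial.C t) ^ k).Monic :=
    fun t k => (Polynomial.monic_X_sub_C t).pow k
  rw [Polynomial.Monic.natDegree_mul (((hm _ _).mul (hm _ _)).mul (hm _ _))
      (Polynomial.monic_X_sub_C β),
    Polynomial.Monic.natDegree_mul ((hm _ _).mul (hm _ _)) (hm _ _),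
    Polynomial.Monic.natDegree_mul (hm _ _) (hm _ _), Polynomial.natDegree_pow,
    Polynomial.natDegree_pow, Polynomial.natDegree_pow] at hdeg
  simp only [Polynomial.natDegree_X_sub_C, mul_one] at hdeg
  rw [LinearMap.det_eq_sign_charpoly_coeff, h, hdeg, Polynomial.coeff_zero_eq_eval_zero]
  simp only [Polynomial.eval_mul, Polynomial.eval_pow, Polynomial.eval_sub, Polynomial.eval_X,
    Polynomial.eval_C, zero_sub, pow_add, pow_one]
  rw [neg_pow x, neg_pow y, neg_pow z]
  have hsq : ∀ k : ℕ, ((-1 : ℝ) ^ k) * (-1) ^ k = 1 := fun k => by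
    rw [← mul_pow]; norm_num
  linear_combination (x ^ (r ^ 2 - 1) * y ^ (2 * r * (d - r)) * z ^ ((d - r) ^ 2 - 1) * β) *
    (((-1 : ℝ) ^ (2 * r * (d - r))) * (-1) ^ (2 * r * (d - r)) *
      (((-1 : ℝ) ^ ((d - r) ^ 2 - 1)) * (-1) ^ ((d - r) ^ 2 - 1)) * hsq (r ^ 2 - 1)
      + (((-1 : ℝ) ^ ((d - r) ^ 2 - 1)) * (-1) ^ ((d - r) ^ 2 - 1)) * hsq (2 * r * (d - r))
      + hsq ((d - r) ^ 2 - 1))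

theorem ellipsoidVol_rhoState (hr : 1 ≤ r) (hrd : r < d) (hs0 : 0 ≤ s) (hs1 : s < 1) :
    ellipsoidVol (rhoState d r s) =
      ballVol d * (aPar d r s ^ (r ^ 2 - 1) * bPar d r s ^ (2 * r * (d - r))
        * cPar d r s ^ ((d - r) ^ 2 - 1) * betaPar d r s) ^ (-(1 / 2) : ℝ) := by
  have ha := aPar_pos hr hrd hs0 hs1
  have hb := bPar_pos hr hrd hs0 hs1
  have hc := cPar_pos hr hrd hs0 hs1
  have hβ := betaPar_pos hr hrd hs0 hs1
  rw [ellipsoidVol, blueMatrix_rhoState hr hrd hs0 hs1, invVal, pinvMat,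
    det_restrictTH_blockSuper hr hrd, Real.rpow_neg (by positivity), ← Real.sqrt_eq_rpow,
    ← Real.sqrt_inv]
  simp only [inv_pow, mul_inv]

lemma ballVol_pos (d : ℕ) : 0 < ballVol d :=
  div_pos (Real.rpow_pos_of_pos Real.pi_pos _) (Real.Gamma_pos_of_pos (by positivity))

theorem log_ellipsoidVol_rhoState (hr : 1 ≤ r) (hrd : r < d) (hs0 : 0 ≤ s) (hs1 : s < 1) :
    Real.log (ellipsoidVol (rhoState d r s)) =
      Real.log (ballVol d) - (1 / 2) * (((r : ℝ) ^ 2 - 1) * Real.log (aPar d r s)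
        + 2 * r * ((d : ℝ) - r) * Real.log (bPar d r s)
        + (((d : ℝ) - r) ^ 2 - 1) * Real.log (cPar d r s)
        + Real.log (betaPar d r s)) := by
  have ha := aPar_pos hr hrd hs0 hs1
  have hb := bPar_pos hr hrd hs0 hs1
  have hc := cPar_pos hr hrd hs0 hs1
  have hβ := betaPar_pos hr hrd hs0 hs1
  have hV := ballVol_pos d
  have e1 : ((r ^ 2 - 1 : ℕ) : ℝ) = (r : ℝ) ^ 2 - 1 := by
    rw [Nat.cast_sub (Nat.one_le_pow _ _ hr)]; push_cast; rfl
  have e2 : (((d - r) ^ 2 - 1 : ℕ) : ℝ) = ((d : ℝ) - r) ^ 2 - 1 := by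
    rw [Nat.cast_sub (Nat.one_le_pow _ _ (by omega)), Nat.cast_pow, Nat.cast_sub hrd.le,
      Nat.cast_one]
  have e3 : ((2 * r * (d - r) : ℕ) : ℝ) = 2 * r * ((d : ℝ) - r) := by
    rw [Nat.cast_mul, Nat.cast_sub hrd.le]; push_cast; rfl
  rw [ellipsoidVol_rhoState hr hrd hs0 hs1, Real.log_mul hV.ne' (by positivity),
    Real.log_rpow (by positivity), Real.log_mul (by positivity) hβ.ne',
    Real.log_mul (by positivity) (by positivity), Real.log_mul (by positivity) (by positivity),
    Real.log_pow, Real.log_pow, Real.log_pow, e1, e2, e3]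
  ring

end Estimation

/-! ### The limit `s → 1`. -/

section Limit

variable {d r : ℕ}

lemma tendsto_lam1 : Tendsto (fun s => lam1 d r s) (𝓝[<] 1) (𝓝 ((r : ℝ)⁻¹)) := by
  have h : Continuous fun s : ℝ => lam1 d r s := by unfold lam1; fun_prop
  have := (h.tendsto 1).mono_left (nhdsWithin_le_nhds (s := Set.Iio 1))
  simpa [lam1] using this

lemma tendsto_lam2 : Tendsto (fun s => lam2 d s) (𝓝[<] 1) (𝓝 0) := by
  have h : Continuous fun s : ℝ => lam2 d s := by unfold lam2; fun_prop
  have := (h.tendsto 1).mono_left (nhdsWithin_le_nhds (s := Set.Iio 1))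
  simpa [lam2] using this

lemma eventually_mem_Ico : ∀ᶠ s : ℝ in 𝓝[<] 1, 0 ≤ s ∧ s < 1 := by
  filter_upwards [self_mem_nhdsWithin,
    mem_nhdsWithin_of_mem_nhds (Ioi_mem_nhds (zero_lt_one (α := ℝ)))] with s h1 h2
  exact ⟨le_of_lt h2, h1⟩

lemma tendsto_hInt_lam (hr : 1 ≤ r) (hrd : r < d) (k n : ℕ) :
    Tendsto (fun s => hInt (lam1 d r s) (lam2 d s) (k + 2) n) (𝓝[<] 1)
      (𝓝 ((((k : ℝ) + 1) * (r : ℝ)⁻¹)⁻¹)) :=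
  tendsto_hInt (inv_pos.2 (by exact_mod_cast hr)) tendsto_lam1 tendsto_lam2
    (eventually_mem_Ico.mono fun _ hs => (lam2_pos hrd hs.2).le) k n

theorem tendsto_aPar (hr : 1 ≤ r) (hrd : r < d) :
    Tendsto (fun s => aPar d r s) (𝓝[<] 1) (𝓝 ((r : ℝ) / (r + 1))) := by
  have h := tendsto_hInt_lam hr hrd r (d - r)
  rw [mul_inv, inv_inv, mul_comm, ← div_eq_mul_inv] at h
  exact h.congr' (eventually_mem_Ico.mono fun s hs => (aPar_eq hr hrd hs.1 hs.2).symm)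

theorem tendsto_bPar (hr : 1 ≤ r) (hrd : r < d) :
    Tendsto (fun s => bPar d r s) (𝓝[<] 1) (𝓝 1) := by
  have hr' : (r : ℝ) ≠ 0 := by exact_mod_cast (by omega : r ≠ 0)
  have h := tendsto_hInt_lam hr hrd (r - 1) (d - r + 1)
  rw [Nat.cast_sub hr, Nat.cast_one, sub_add_cancel, mul_inv_cancel₀ hr', inv_one,
    show r - 1 + 2 = r + 1 by omega] at h
  exact h.congr' (eventually_mem_Ico.mono fun s hs => (bPar_eq hr hrd hs.1 hs.2).symm)

/-- Here `λ₁` carries only the exponent `r`, so `2 ≤ r` is what makes the limiting integral of `(1 +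
z / r)^(-r)` converge. -/
theorem tendsto_cPar (hr : 2 ≤ r) (hrd : r < d) :
    Tendsto (fun s => cPar d r s) (𝓝[<] 1) (𝓝 ((r : ℝ) / (r - 1))) := by
  have h := tendsto_hInt_lam (by omega) hrd (r - 2) (d - r + 2)
  rw [Nat.cast_sub hr, Nat.cast_ofNat, show (r : ℝ) - 2 + 1 = r - 1 by ring, mul_inv, inv_inv,
    mul_comm, ← div_eq_mul_inv, show r - 2 + 2 = r by omega] at h
  exact h.congr' (eventually_mem_Ico.mono fun s hs => (cPar_eq (by omega) hrd hs.1 hs.2).symm)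

theorem tendsto_scaledMSE (hr : 2 ≤ r) (hrd : r < d) :
    Tendsto (fun s => scaledMSE (rhoState d r s)) (𝓝[<] 1)
      (𝓝 ((d : ℝ) ^ 2 + 2 * d - 1 - (d : ℝ) ^ 2 / r - 1 / r)) := by
  have hr1 : 1 ≤ r := by omega
  have hr2 : (2 : ℝ) ≤ r := by exact_mod_cast hr
  have hr' : (r : ℝ) ≠ 0 := by linarith
  have hrm : (r : ℝ) - 1 ≠ 0 := by linarith
  have hrp : (r : ℝ) + 1 ≠ 0 := by linarith
  have hd' : (d : ℝ) ≠ 0 := by exact_mod_cast (by omega : d ≠ 0)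
  have ha := tendsto_aPar hr1 hrd
  have hb := tendsto_bPar hr1 hrd
  have hc := tendsto_cPar hr hrd
  -- In the limit `β` coincides with `c`.
  have hβ : Tendsto (fun s => betaPar d r s) (𝓝[<] 1) (𝓝 ((r : ℝ) / (r - 1))) := by
    have h := (((ha.const_mul ((r + 1) * ((d : ℝ) - r))).add
      (hc.const_mul (r * ((d : ℝ) - r + 1)))).sub
        (hb.const_mul (2 * r * ((d : ℝ) - r)))).div_const (d : ℝ)
    have e : ((r + 1) * ((d : ℝ) - r) * (r / (r + 1)) + r * ((d : ℝ) - r + 1) * (r / (r - 1))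
        - 2 * r * ((d : ℝ) - r) * 1) / d = r / (r - 1) := by
      field_simp
      ring
    rw [e] at h
    exact h
  have h := ((((tendsto_const_nhds (x := (r : ℝ) ^ 2 - 1)).div ha (by positivity)).add
    ((tendsto_const_nhds (x := 2 * r * ((d : ℝ) - r))).div hb one_ne_zero)).add
    ((tendsto_const_nhds (x := ((d : ℝ) - r) ^ 2 - 1)).div hc (by positivity))).add
    ((tendsto_const_nhds (x := (1 : ℝ))).div hβ (by positivity))
  have h' := h.congr' (eventually_mem_Ico.mono fun s hs =>
    (scaledMSE_rhoState hr1 hrd hs.1 hs.2).symm)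
  convert h' using 2
  field_simp
  ring

end Limit

/-! ### The common eigenvectors `E_{jk}^±`. -/

section Eigenvectors

variable {d r : ℕ}

lemma blockSuper_Eplus {v : Fin d → Fin d → ℝ} (hv : ∀ i j, v i j = v j i)
    (N : Matrix (Fin d) (Fin d) ℝ) {j k : Fin d} (h : j ≠ k) :
    blockSuper v N (Eplus j k) = ((v j k : ℝ) : ℂ) • Eplus j k := by
  rw [Eplus, map_smul, map_add, blockSuper_E v N h, blockSuper_E v N h.symm, hv k j, ← smul_add,
    smul_comm]

lemma blockSuper_Eminus {v : Fin d → Fin d → ℝ} (hv : ∀ i j, v i j = v j i)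
    (N : Matrix (Fin d) (Fin d) ℝ) {j k : Fin d} (h : j ≠ k) :
    blockSuper v N (Eminus j k) = ((v j k : ℝ) : ℂ) • Eminus j k := by
  rw [Eminus, map_smul, map_sub, blockSuper_E v N h, blockSuper_E v N h.symm, hv k j, ← smul_sub,
    smul_comm]

end Eigenvectors

end CovTomo

end

/-! ### The theorem, read off from the block forms. -/

open CovTomo in
theorem mainTheorem5 (d r : ℕ) (hr : 1 ≤ r) (hrd : r < d) :
    (∀ s : ℝ, 0 ≤ s → s < 1 →
      -- the parameters are positive and the measurement is informationally complete
      (0 < aPar d r s ∧ 0 < bPar d r s ∧ 0 < cPar d r s ∧ 0 < betaPar d r s) ∧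
      IsUnit (frame (rhoState d r s)) ∧
      -- the frame superoperator and the Fisher information superoperator
      frame (rhoState d r s) =
        ((aPar d r s : ℝ) : ℂ) • P1 d r + ((bPar d r s : ℝ) : ℂ) • P2 d r
          + ((cPar d r s : ℝ) : ℂ) • P3 d r + diagSuper (Mmat d r s) ∧
      fisher (rhoState d r s) =
        ((aPar d r s : ℝ) : ℂ) • P1 d r + ((bPar d r s : ℝ) : ℂ) • P2 d r
          + ((cPar d r s : ℝ) : ℂ) • P3 d r + diagSuper (Mbar d r s) ∧
      -- the spectrum of `M̄`; the factor `X` belongs to the all-ones vector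
      (Mbar d r s).IsSymm ∧
      (Mbar d r s).charpoly =
        Polynomial.X * (Polynomial.X - Polynomial.C (aPar d r s)) ^ (r - 1)
          * (Polynomial.X - Polynomial.C (cPar d r s)) ^ (d - r - 1)
          * (Polynomial.X - Polynomial.C (betaPar d r s)) ∧
      -- the `E_{jk}^±` are common eigenvectors
      (∀ j k : Fin d, j ≠ k →
        frame (rhoState d r s) (Eplus j k) = ((blockVal d r s j k : ℝ) : ℂ) • Eplus j k ∧
        frame (rhoState d r s) (Eminus j k) = ((blockVal d r s j k : ℝ) : ℂ) • Eminus j k ∧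
        fisher (rhoState d r s) (Eplus j k) = ((blockVal d r s j k : ℝ) : ℂ) • Eplus j k ∧
        fisher (rhoState d r s) (Eminus j k) = ((blockVal d r s j k : ℝ) : ℂ) • Eminus j k) ∧
      -- `F̄` is Hermitian, kills the identity, preserves the traceless Hermitian operators and has
      -- the stated eigenvalues, with multiplicity, there
      (∀ X Y : Op d, (Xᴴ * fisher (rhoState d r s) Y).trace
        = ((fisher (rhoState d r s) X)ᴴ * Y).trace) ∧
      fisher (rhoState d r s) 1 = 0 ∧
      (∀ X ∈ tracelessHerm d, fisher (rhoState d r s) X ∈ tracelessHerm d) ∧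
      (restrictTH (fisher (rhoState d r s))).charpoly =
        (Polynomial.X - Polynomial.C (aPar d r s)) ^ (r ^ 2 - 1)
          * (Polynomial.X - Polynomial.C (bPar d r s)) ^ (2 * r * (d - r))
          * (Polynomial.X - Polynomial.C (cPar d r s)) ^ ((d - r) ^ 2 - 1)
          * (Polynomial.X - Polynomial.C (betaPar d r s)) ∧
      -- the scaled MSE
      scaledMSE (rhoState d r s) =
        ((r : ℝ) ^ 2 - 1) / aPar d r s + 2 * r * ((d : ℝ) - r) / bPar d r s
          + (((d : ℝ) - r) ^ 2 - 1) / cPar d r s + 1 / betaPar d r s ∧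
      -- the scaled MSB
      scaledMSB (rhoState d r s) =
        (1 / 4) * (((r : ℝ) ^ 2 - 1) / (aPar d r s * lam1 d r s)
          + 4 * r * ((d : ℝ) - r) / (bPar d r s * (lam1 d r s + lam2 d s))
          + (((d : ℝ) - r) ^ 2 - 1) / (cPar d r s * lam2 d s)
          + ((d : ℝ) - r) / (d * betaPar d r s * lam1 d r s)
          + r / (d * betaPar d r s * lam2 d s)) ∧
      -- the volume of the scaled uncertainty ellipsoid and its logarithm
      ellipsoidVol (rhoState d r s) =
        ballVol d * (aPar d r s ^ (r ^ 2 - 1) * bPar d r s ^ (2 * r * (d - r))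
          * cPar d r s ^ ((d - r) ^ 2 - 1) * betaPar d r s) ^ (-(1 / 2) : ℝ) ∧
      Real.log (ellipsoidVol (rhoState d r s)) =
        Real.log (ballVol d) - (1 / 2) * (((r : ℝ) ^ 2 - 1) * Real.log (aPar d r s)
          + 2 * r * ((d : ℝ) - r) * Real.log (bPar d r s)
          + (((d : ℝ) - r) ^ 2 - 1) * Real.log (cPar d r s)
          + Real.log (betaPar d r s))) ∧
    -- the integral by which the `g_{jk}` are evaluated
    (∀ (m : ℕ) (u : ℝ), 0 < u →
      ∫ α in (0 : ℝ)..(Real.pi / 2),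
          Real.cos α * Real.sin α ^ (2 * m + 1) / (Real.cos α ^ 2 + u) =
        (1 / 2) * (1 + u) ^ m * Real.log ((1 + u) / u)
          - (1 / 2) * ∑ n ∈ Finset.range m, (1 + u) ^ n / ((m : ℝ) - n)) ∧
    -- the limit `s → 1`
    (2 ≤ r →
      Tendsto (fun s => aPar d r s) (𝓝[<] 1) (𝓝 ((r : ℝ) / (r + 1))) ∧
      Tendsto (fun s => bPar d r s) (𝓝[<] 1) (𝓝 1) ∧
      Tendsto (fun s => cPar d r s) (𝓝[<] 1) (𝓝 ((r : ℝ) / (r - 1))) ∧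
      Tendsto (fun s => scaledMSE (rhoState d r s)) (𝓝[<] 1)
        (𝓝 ((d : ℝ) ^ 2 + 2 * d - 1 - (d : ℝ) ^ 2 / r - 1 / r))) := by
  refine ⟨fun s hs0 hs1 => ?_, fun m u hu => integral_cos_mul_sin_pow_div m hu, fun hr2 =>
    ⟨tendsto_aPar hr hrd, tendsto_bPar hr hrd, tendsto_cPar hr2 hrd, tendsto_scaledMSE hr2 hrd⟩⟩
  have hF := frame_rhoState hr hrd hs0 hs1
  have hFi := fisher_rhoState hr hrd hs0 hs1
  have hv : ∀ i j : Fin d, blockVal d r s i j = blockVal d r s j i := fun i j => blk_comm _ _ _ i j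
  have hsum := sum_specMat hr hrd (aPar d r s) (cPar d r s) (betaPar d r s)
  have hsymm := isSymm_specMat (d := d) (r := r) (aPar d r s) (cPar d r s) (betaPar d r s)
  have hM := Mbar_eq (s := s) hr hrd
  refine ⟨⟨aPar_pos hr hrd hs0 hs1, bPar_pos hr hrd hs0 hs1, cPar_pos hr hrd hs0 hs1,
    betaPar_pos hr hrd hs0 hs1⟩,
    ⟨⟨_, _, frame_mul_inv hr hrd hs0 hs1, inv_mul_frame hr hrd hs0 hs1⟩, rfl⟩,
    hF.trans (blockSuper_eq_sum _ _ _ _), hFi.trans (blockSuper_eq_sum _ _ _ _), ?_, ?_,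
    fun j k hjk => ?_, ?_, ?_, fun X hX => ?_, ?_, scaledMSE_rhoState hr hrd hs0 hs1,
    scaledMSB_rhoState hr hrd hs0 hs1, ellipsoidVol_rhoState hr hrd hs0 hs1,
    log_ellipsoidVol_rhoState hr hrd hs0 hs1⟩
  · rw [hM]
    exact hsymm
  · rw [hM]
    exact charpoly_specMat hr hrd _ _ _
  · rw [hF, hFi]
    exact ⟨blockSuper_Eplus hv _ hjk, blockSuper_Eminus hv _ hjk, blockSuper_Eplus hv _ hjk,
      blockSuper_Eminus hv _ hjk⟩
  · rw [hFi, hM]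
    exact blockSuper_symm _ _ hsymm
  · rw [hFi, hM]
    exact blockSuper_apply_one hsum
  · rw [hFi, hM]
    refine blockSuper_mem_tracelessHerm hv (fun k => ?_) hX
    -- Preservation of the trace needs vanishing column sums, which symmetry turns into row sums.
    simp_rw [fun i => hsymm.apply k i]
    exact hsum k
  · rw [hFi, hM]
    exact charpoly_restrictTH_blockSuper hr hrd _ _ _ _
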